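/- Let $M\subseteq\mathbb R^d$ be a nonempty $m$-dimensional $C^k$ submanifold, $m<d$, $k\ge 2$ (every $\xi\in M$ lies in an open $U\subseteq\mathbb R^d$ for which there are an open $W\subseteq\mathbb R^d$ and a $C^k$ diffeomorphism $\Psi:W\to U$ with $\Psi(y)\in M\iff y_{m+1}=\dots=y_d=0$ for all $y\in W$). Write $M^r=\{x\in\mathbb R^d: d(x,M)<r\}$, let $\operatorname{unpp}(M)$ be the set of points of $\mathbb R^d$ having a unique nearest point on $M$, let $p:\operatorname{unpp}(M)\to M$ map $x$ to that point, and let $\operatorname{reach}(M)=\sup\{r\in(0,\infty): M^r\subseteq\operatorname{unpp}(M)\}\in[0,\infty]$. Assume $\operatorname{reach}(M)>0$ and let $\varepsilon\in(0,\operatorname{reach}(M))$. For a map $f$ from a relatively open $V\subseteq M$ into a normed space $F$, $Df(\xi)$ denotes the derivative $T_\xi(M)\to F$, extended by $0$ on the normal space $T_\xi(M)^\perp$ to a linear map on $\mathbb R^d$; the higher derivatives are $D^{j+1}f=D(D^jf)$, with the operator norm of multilinear maps. (a) Suppose there are a constant $K\in(0,\infty)$ and a family $(V_i,n_{i,m+1},\dots,n_{i,d})_{i\in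 I}$ of orthonormal moving frames of the normal bundle of $M$ of class $C^{k-1}$ (that is, $V_i\subseteq M$ is relatively open, the $n_{i,\ell}:V_i\to\mathbb R^d$ are $C^{k-1}$, and $n_{i,m+1}(\eta),\dots,n_{i,d}(\eta)$ are orthonormal and orthogonal to $T_\eta(M)$ for every $\eta\in V_i$) such that $M=\bigcup_{i\in I}V_i$ and $\|D^jn_{i,\ell}(\xi)\|\le K$ for all $i\in I$, $\ell\in\{m+1,\dots,d\}$, $j\in\{2,\dots,k-1\}$ and $\xi\in V_i$. Then $p$ is $C^{k-1}$ on $M^\varepsilon$ and $D^jp$ is bounded on $M^\varepsilon$ for every $j\in\{2,\dots,k-1\}$. (b) Suppose that $m=d-1$ and that there is a constant $K\in(0,\infty)$ such that for every $j\in\{2,\dots,k-1\}$ and every $\xi\in M$ there is a unit normal field $n$ of $M$ (a continuous map with $\|n(\eta)\|=1$ and $n(\eta)\perp T_\eta(M)$), defined on a relatively open subset of $M$ containing $\xi$, with $\|D^jn(\xi)\|\le K$. (Such fields are automatically $C^{k-1}$ and unique near $\xi$ up to sign, so that $\|D^jn(\xi)\|$ does not depend on the choice.) Then $p$ is $C^{k-1}$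 on $M^\varepsilon$ and $D^jp$ is bounded on $M^\varepsilon$ for every $j\in\{2,\dots,k-1\}$. -/

import Mathlib

open Set Metric
open scoped ENNReal

/-- `ℝ^d` with the Euclidean norm. -/
abbrev EucSp (d : ℕ) : Type := EuclideanSpace ℝ (Fin d)

/-- `M` is an `m`-dimensional `C^k` submanifold of `ℝ^d`: around every point of `M` there is a
`C^k` diffeomorphism `Ψ` between open subsets of `ℝ^d` (a homeomorphism if `k = 0`) that
straightens `M` to `{y | y_{m+1} = ⋯ = y_d = 0}`. The dimensions satisfy `m < d`. -/
def IsSubmanifold {d : ℕ} (k m : ℕ) (M : Set (EucSp d)) : Prop :=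
  m < d ∧ ∀ ξ ∈ M, ∃ Ψ : OpenPartialHomeomorph (EucSp d) (EucSp d),
    ξ ∈ Ψ.target ∧ ContDiffOn ℝ k Ψ Ψ.source ∧ ContDiffOn ℝ k Ψ.symm Ψ.target ∧
      ∀ y ∈ Ψ.source, (Ψ y ∈ M ↔ ∀ i : Fin d, m ≤ (i : ℕ) → y i = 0)

/-- The points of `ℝ^d` that have a unique nearest point on `M`. -/
def unpp {d : ℕ} (M : Set (EucSp d)) : Set (EucSp d) :=
  {x | ∃! ξ, ξ ∈ M ∧ ‖x - ξ‖ = infDist x M}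

open Classical in
/-- The orthogonal projection `p` onto `M`: for `x ∈ unpp M` it is the unique nearest point
to `x` on `M`. Outside `unpp M` the value is irrelevant (we take `x`). -/
noncomputable def nearestPt {d : ℕ} (M : Set (EucSp d)) (x : EucSp d) : EucSp d :=
  if h : x ∈ unpp M then (ExistsUnique.exists h).choose else x

theorem nearestPt_spec {d : ℕ} {M : Set (EucSp d)} {x : EucSp d} (hx : x ∈ unpp M) :
    nearestPt M x ∈ M ∧ ‖x - nearestPt M x‖ = infDist x M := by
  unfold nearestPt
  rw [dif_pos hx]
  exact (ExistsUnique.exists hx).choose_spec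

/-- The reach of `M`, an element of `[0, ∞]`: the supremum of all `r ∈ (0, ∞)` such that the
`r`-neighbourhood `M^r = {x | d(x, M) < r}` consists of points with a unique nearest point. -/
noncomputable def reach {d : ℕ} (M : Set (EucSp d)) : ℝ≥0∞ :=
  ⨆ (r : ℝ) (_ : 0 < r ∧ thickening r M ⊆ unpp M), ENNReal.ofReal r

/-- The tangent space `T_ξ(M)`: the velocities at `ξ` of `C^1` curves `γ : (-1,1) → M` with
`γ 0 = ξ`. For a `C^1` submanifold these velocities already form a linear subspace, so that
taking the span adds nothing; it only provides the type `Submodule`. -/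
def tangentSp {d : ℕ} (M : Set (EucSp d)) (ξ : EucSp d) : Submodule ℝ (EucSp d) :=
  Submodule.span ℝ {t | ∃ γ : ℝ → EucSp d, ContDiffOn ℝ 1 γ (Ioo (-1) 1) ∧
    (∀ s ∈ Ioo (-1 : ℝ) 1, γ s ∈ M) ∧ γ 0 = ξ ∧ HasDerivAt γ t 0}

/-- `V` is a (relatively) open subset of `M`. -/
def IsOpenSubset {d : ℕ} (M V : Set (EucSp d)) : Prop :=
  ∃ U : Set (EucSp d), IsOpen U ∧ V = M ∩ U

/-- `(V, n)` is a unit normal field of `M`. Only the values of `n` on `V` matter. -/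
structure IsUnitNormalField {d : ℕ} (M V : Set (EucSp d)) (n : EucSp d → EucSp d) : Prop where
  isOpenSubset : IsOpenSubset M V
  continuousOn : ContinuousOn n V
  norm_eq_one : ∀ η ∈ V, ‖n η‖ = 1
  normal : ∀ η ∈ V, n η ∈ (tangentSp M η)ᗮ

/-- `(V, n_{m+1}, …, n_d)` is an orthonormal moving frame of the normal bundle of the
`m`-dimensional submanifold `M` over `V`; the `d - m` fields are indexed by `Fin (d - m)`. -/
structure IsMovingFrame {d : ℕ} (m : ℕ) (M V : Set (EucSp d))
    (n : Fin (d - m) → EucSp d → EucSp d) : Prop where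
  isOpenSubset : IsOpenSubset M V
  continuousOn : ∀ l, ContinuousOn (n l) V
  orthonormal : ∀ η ∈ V, Orthonormal ℝ (fun l => n l η)
  normal : ∀ l, ∀ η ∈ V, n l η ∈ (tangentSp M η)ᗮ

/-- The derivative `Df(ξ) : T_ξ(M) → F` of a map `f : V → F` on an open subset `V` of the
submanifold `M`, extended by zero to the normal space, i.e. composed with the orthogonal
projection of `ℝ^d` onto `T_ξ(M)`. (A Fréchet derivative of `f` within `V` at `ξ` is determined
precisely on `T_ξ(M)`, so the composition does not depend on the choice made by `fderivWithin`.) -/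
noncomputable def tangentialFDeriv {d : ℕ} {F : Type*} [NormedAddCommGroup F] [NormedSpace ℝ F]
    (M V : Set (EucSp d)) (f : EucSp d → F) (ξ : EucSp d) : EucSp d →L[ℝ] F :=
  (fderivWithin ℝ f V ξ).comp (tangentSp M ξ).starProjection

/-- The iterated derivative `D^j f(ξ)` of a map `f : V → F` on an open subset `V` of the
submanifold `M`, a `j`-linear map on `ℝ^d`: `D^0 f = f` and `D^{j+1} f = D (D^j f)`. -/
noncomputable def iteratedTangentialFDeriv {d : ℕ} {F : Type*} [NormedAddCommGroup F]
    [NormedSpace ℝ F] (M V : Set (EucSp d)) (f : EucSp d → F) :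
    (j : ℕ) → EucSp d → ContinuousMultilinearMap ℝ (fun _ : Fin j => EucSp d) F
  | 0 => fun ξ => ContinuousMultilinearMap.uncurry0 ℝ (EucSp d) (f ξ)
  | j + 1 => fun ξ =>
      (tangentialFDeriv M V (iteratedTangentialFDeriv M V f j) ξ).uncurryLeft

open Filter Topology

/-! ### Distance function and nearest points inside the reach. -/

section NearestPoint

variable {d : ℕ} {M : Set (EucSp d)} {r : ℝ}

/-! Write `p` for the nearest point map and pick `r > ε` with `thickening r M ⊆ unpp M`. For `x` off
`M`, the distance to `M` grows at unit speed along the ray from `p x` through `x` as long as it is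
below `r`. So a ball of radius `(ε + r) / 2` touches `M` at `p x` from the side of `x`, which says
`⟪η - p x, x - p x⟫ ≤ θ / 2 * ‖η - p x‖ ^ 2` for `η ∈ M`, where `θ = 2 * ε / (ε + r) < 1`
(`inner_sub_nearestPt_le`). This inequality has two consequences. It makes `p` Lipschitz on the
`ε`-neighbourhood (`norm_nearestPt_sub_le`). Its second-order part bounds the second fundamental
form paired with `x - p x` by `θ` (`neg_inner_fderiv_le`), so the system "`ζ ∈ M` and `x - ζ` is
normal at `ζ`" is nondegenerate at `ζ = p x`, and the implicit function theorem gives `p` of class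
`C^(k-1)` (`IsSubmanifold.contDiffAt_nearestPt`).

For the bounds, let `R` be the normal projection at `p x`, written through the frame, and `P = 1 -
R`. Differentiating `x - p x = R (x - p x)` gives `B * (Dp + R) = 1` with `B = 1 + ∑ ⟪n_l, x - p x⟫
P ∘ Dn_l` (`shapeOp_mul_eq_one`), that is, `Dp = B⁻¹ - R`. The right side depends on `p` only
through `x - p x`, `n_l ∘ p` and `Dn_l ∘ p`, and the derivative of `D^i n_l ∘ p` is `D^(i+1) n_l ∘
p` composed with `Dp`. Bounds for `Dp` up to order `j` therefore give bounds for `B` and `R`, hence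
for `Dp`, up to order `j + 1` (`unifBdd_fderiv_of_tower`). The induction starts from the Lipschitz
constant. The missing bound on `Dn_l` follows from the one on `D²n_l`, because the fields have unit
length.

For a hypersurface, smooth local unit normals exist and are unique up to sign, so they form moving
frames satisfying the same bounds. -/

theorem exists_thickening_subset_unpp {ε : ℝ} (h : ENNReal.ofReal ε < reach M) :
    ∃ r, ε < r ∧ thickening r M ⊆ unpp M := by
  unfold reach at h
  obtain ⟨r, hr⟩ := lt_iSup_iff.1 h
  obtain ⟨⟨h0, hr'⟩, hlt⟩ := lt_iSup_iff.1 hr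
  exact ⟨r, (ENNReal.ofReal_lt_ofReal_iff h0).1 hlt, hr'⟩

theorem nearestPt_mem {x : EucSp d} (hx : x ∈ unpp M) : nearestPt M x ∈ M :=
  (nearestPt_spec hx).1

theorem norm_sub_nearestPt {x : EucSp d} (hx : x ∈ unpp M) :
    ‖x - nearestPt M x‖ = infDist x M :=
  (nearestPt_spec hx).2

theorem nearestPt_eq {x ξ : EucSp d} (hx : x ∈ unpp M) (hξ : ξ ∈ M)
    (h : ‖x - ξ‖ = infDist x M) : nearestPt M x = ξ :=
  ExistsUnique.unique hx (nearestPt_spec hx) ⟨hξ, h⟩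

theorem infDist_le_norm_sub {x ξ : EucSp d} (hξ : ξ ∈ M) : infDist x M ≤ ‖x - ξ‖ :=
  dist_eq_norm x ξ ▸ infDist_le_dist_of_mem hξ

theorem nearestPt_of_mem (hr : 0 < r) (hM : thickening r M ⊆ unpp M) {ξ : EucSp d} (hξ : ξ ∈ M) :
    nearestPt M ξ = ξ :=
  nearestPt_eq (hM (self_subset_thickening hr M hξ)) hξ (by simp [infDist_zero_of_mem hξ])

/-- A point of the closure has distance zero to `M`, so it coincides with its nearest point. -/
theorem isClosed_of_thickening_subset_unpp (hr : 0 < r) (hM : thickening r M ⊆ unpp M) :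
    IsClosed M := by
  refine isClosed_of_closure_subset fun x hx => ?_
  have hx' : x ∈ unpp M := hM (closure_subset_thickening hr M hx)
  have h1 := norm_sub_nearestPt hx'
  have h2 : infDist x M = 0 := by
    rw [← infDist_closure]; exact infDist_zero_of_mem hx
  rw [h2, norm_eq_zero, sub_eq_zero] at h1
  rw [h1]; exact nearestPt_mem hx'

/-- Nearest points of points near `x` stay in a compact ball. Each of their cluster points lies in
the closed set `M` and realises the distance from `x`, so uniqueness leaves only one. -/
theorem continuousAt_nearestPt (hM : thickening r M ⊆ unpp M) {x : EucSp d}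
    (hx : x ∈ thickening r M) : ContinuousAt (nearestPt M) x := by
  have hr : 0 < r := by
    by_contra h
    simp [thickening_of_nonpos (not_lt.1 h)] at hx
  have hcl := isClosed_of_thickening_subset_unpp hr hM
  have hnhds : ∀ᶠ y in 𝓝 x, y ∈ thickening r M := isOpen_thickening.mem_nhds hx
  refine IsCompact.tendsto_nhds_of_unique_mapClusterPt
    (isCompact_closedBall x (infDist x M + 2)) ?_ ?_
  · have h1 : ∀ᶠ y in 𝓝 x, infDist y M < infDist x M + 1 :=
      (continuous_infDist_pt M).continuousAt.eventually_lt continuousAt_const (by simp)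
    have h2 : ∀ᶠ y in 𝓝 x, dist y x < 1 := Metric.ball_mem_nhds x one_pos
    filter_upwards [hnhds, h1, h2] with y hy h1 h2
    rw [mem_closedBall]
    have := norm_sub_nearestPt (hM hy)
    rw [← dist_eq_norm, dist_comm] at this
    linarith [dist_triangle (nearestPt M y) y x]
  · intro z _ hz
    obtain ⟨U, hU, hUz⟩ := mapClusterPt_iff_ultrafilter.1 hz
    have hin : ∀ᶠ y in (U : Filter (EucSp d)), y ∈ thickening r M := hU hnhds
    have hzM : z ∈ M := hcl.mem_of_tendsto hUz (hin.mono fun y hy => nearestPt_mem (hM hy))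
    refine (nearestPt_eq (hM hx) hzM ?_).symm
    have hid : Tendsto (fun y : EucSp d => y) U (𝓝 x) := hU
    have h1 : Tendsto (fun y => ‖y - nearestPt M y‖) U (𝓝 ‖x - z‖) := (hid.sub hUz).norm
    have h2 : Tendsto (fun y => infDist y M) U (𝓝 (infDist x M)) :=
      ((continuous_infDist_pt M).tendsto x).comp hid
    exact tendsto_nhds_unique h1
      (h2.congr' (hin.mono fun y hy => (norm_sub_nearestPt (hM hy)).symm))

/-- Moving away from the nearest point increases the distance function at unit speed. -/
theorem exists_infDist_gt (hM : thickening r M ⊆ unpp M) {y : EucSp d}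
    (hy : y ∈ thickening r M) (hy0 : 0 < infDist y M) {c : ℝ} (hc : c < 1) {u : EucSp d}
    (hu : u = (infDist y M)⁻¹ • (y - nearestPt M y)) :
    ∀ᶠ h in 𝓝[>] (0 : ℝ), infDist y M + c * h < infDist (y + h • u) M := by
  set δ := infDist y M with hδ
  have hu1 : ‖u‖ = 1 := by
    rw [hu, norm_smul, norm_sub_nearestPt (hM hy), ← hδ, norm_inv, Real.norm_of_nonneg hy0.le,
      inv_mul_cancel₀ hy0.ne']
  have hline : ContinuousAt (fun h : ℝ => y + h • u) 0 := by fun_prop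
  have hl0 : y + (0 : ℝ) • u = y := by simp
  have hmem : ∀ᶠ h in 𝓝 (0 : ℝ), y + h • u ∈ thickening r M :=
    hline.eventually (by simpa using isOpen_thickening.mem_nhds hy)
  have hp : ContinuousAt (fun h : ℝ => nearestPt M (y + h • u)) 0 :=
    ContinuousAt.comp (f := fun h : ℝ => y + h • u) (g := nearestPt M)
      (by rw [hl0]; exact continuousAt_nearestPt hM hy) hline
  -- The subtracted term is chosen so that `2 * h` times it equals `(δ + c * h) ^ 2 - δ ^ 2`. The
  -- inner product tends to `δ > c * δ` by continuity of the nearest point map.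
  have hin : ContinuousAt (fun h : ℝ => inner ℝ u (y - nearestPt M (y + h • u)) -
      (c ^ 2 * h / 2 + c * δ)) 0 := by fun_prop
  have hval : inner ℝ u (y - nearestPt M y) = δ := by
    rw [hu, real_inner_smul_left, real_inner_self_eq_norm_sq, norm_sub_nearestPt (hM hy), ← hδ]
    field_simp
  have hpos : ∀ᶠ h in 𝓝 (0 : ℝ), 0 < inner ℝ u (y - nearestPt M (y + h • u)) -
      (c ^ 2 * h / 2 + c * δ) := by
    refine continuousAt_const.eventually_lt hin ?_
    simp only [hl0, hval]
    nlinarith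
  filter_upwards [hmem.filter_mono nhdsWithin_le_nhds, hpos.filter_mono nhdsWithin_le_nhds,
    self_mem_nhdsWithin] with h h1 h2 h3
  have h3 : 0 < h := h3
  set q := nearestPt M (y + h • u) with hq
  have e1 : infDist (y + h • u) M ^ 2 = ‖y - q‖ ^ 2 + 2 * h * inner ℝ u (y - q) + h ^ 2 := by
    rw [← norm_sub_nearestPt (hM h1), ← hq,
      show y + h • u - q = (y - q) + h • u by abel, norm_add_sq_real, norm_smul, hu1,
      real_inner_smul_right, real_inner_comm, Real.norm_of_nonneg h3.le]
    ring
  have e2 : δ ≤ ‖y - q‖ := infDist_le_norm_sub (nearestPt_mem (hM h1))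
  refine lt_of_pow_lt_pow_left₀ 2 infDist_nonneg ?_
  rw [e1]
  have e3 : δ ^ 2 ≤ ‖y - q‖ ^ 2 := by gcongr
  nlinarith [mul_pos h3 h2, mul_pos h3 h3]

/-- A variational argument replaces following the gradient flow of the distance: growth at every
rate `c < 1` is obtained by maximisation, and then `c → 1`. -/
theorem exists_infDist_eq_add (hM : thickening r M ⊆ unpp M) {x : EucSp d} (hne : M.Nonempty)
    (hx0 : 0 < infDist x M) {s : ℝ} (hs : 0 < s) (hsr : infDist x M + s < r) :
    ∃ y, ‖y - x‖ = s ∧ infDist y M = infDist x M + s := by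
  have hin : ∀ y ∈ closedBall x s, y ∈ thickening r M := by
    intro y hy
    rw [mem_thickening_iff_infDist_lt hne]
    have := infDist_le_infDist_add_dist (s := M) (x := y) (y := x)
    rw [mem_closedBall] at hy
    linarith
  have key : ∀ c : ℝ, 0 ≤ c → c < 1 →
      ∃ y ∈ sphere x s, infDist x M + c * s ≤ infDist y M := by
    intro c hc0 hc
    -- A maximiser of this penalised distance cannot be interior: moving away from its nearest point
    -- would gain more than `c * h` in distance and cost at most `c * h`.
    obtain ⟨y, hy, hmax⟩ := (isCompact_closedBall x s).exists_isMaxOn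
      ⟨x, mem_closedBall_self hs.le⟩
      (f := fun y => infDist y M - c * dist y x) (by
        have := continuous_infDist_pt M
        fun_prop)
    have h0 : infDist x M + c * dist y x ≤ infDist y M := by
      have := hmax (mem_closedBall_self hs.le)
      simp only [mem_ofPred_eq, dist_self] at this
      linarith
    rcases (mem_closedBall.1 hy).lt_or_eq with hlt | heq
    · exfalso
      have hy0 : 0 < infDist y M := lt_of_lt_of_le hx0 (by
        have := mul_nonneg hc0 (dist_nonneg (x := y) (y := x)); linarith)
      set u := (infDist y M)⁻¹ • (y - nearestPt M y) with hu
      have hu1 : ‖u‖ = 1 := by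
        rw [hu, norm_smul, norm_sub_nearestPt (hM (hin y hy)), norm_inv,
          Real.norm_of_nonneg hy0.le, inv_mul_cancel₀ hy0.ne']
      have h1 := exists_infDist_gt hM (hin y hy) hy0 hc hu
      have hline : ContinuousAt (fun h : ℝ => y + h • u) 0 := by fun_prop
      have h2 : ∀ᶠ h in 𝓝 (0 : ℝ), y + h • u ∈ closedBall x s :=
        hline.eventually (mem_of_superset (isOpen_ball.mem_nhds (by simpa using hlt))
          ball_subset_closedBall)
      obtain ⟨h, h1, h2, h3⟩ :=
        (h1.and ((h2.filter_mono nhdsWithin_le_nhds).and self_mem_nhdsWithin)).exists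
      have h3 : 0 < h := h3
      have h4 := hmax h2
      simp only [mem_ofPred_eq] at h4
      have h5 : dist (y + h • u) x ≤ dist y x + h := by
        have h6 : dist (y + h • u) y = h := by simp [dist_eq_norm, norm_smul, hu1, h3.le]
        linarith [dist_triangle (y + h • u) y x]
      nlinarith [mul_le_mul_of_nonneg_left h5 hc0]
    · exact ⟨y, mem_sphere.2 heq, heq ▸ h0⟩
  obtain ⟨y0, hy0, -⟩ := key 0 le_rfl one_pos
  obtain ⟨y, hy, hmax⟩ := (isCompact_sphere x s).exists_isMaxOn ⟨y0, hy0⟩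
    (f := fun y => infDist y M) (continuous_infDist_pt M).continuousOn
  have hys : dist y x = s := hy
  refine ⟨y, by rwa [← dist_eq_norm], le_antisymm ?_ ?_⟩
  · have := infDist_le_infDist_add_dist (s := M) (x := y) (y := x)
    linarith
  · have hlim : Tendsto (fun c : ℝ => infDist x M + c * s) (𝓝[<] 1) (𝓝 (infDist x M + 1 * s)) := by
      have : Continuous fun c : ℝ => infDist x M + c * s := by fun_prop
      exact (this.tendsto 1).mono_left nhdsWithin_le_nhds
    rw [one_mul] at hlim
    refine le_of_tendsto hlim ?_
    have h0 : ∀ᶠ c in 𝓝[<] (1 : ℝ), 0 ≤ c :=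
      (eventually_ge_nhds one_pos).filter_mono nhdsWithin_le_nhds
    filter_upwards [h0, self_mem_nhdsWithin] with c hc0 hc1
    obtain ⟨z, hz, hz'⟩ := key c hc0 hc1
    exact hz'.trans (hmax hz)

/-- Inside the reach, the nearest point is constant along normal rays. -/
theorem infDist_add_smul (hM : thickening r M ⊆ unpp M) {x : EucSp d} (hne : M.Nonempty)
    (hx0 : 0 < infDist x M) {s : ℝ} (hs : 0 < s) (hsr : infDist x M + s < r) :
    infDist (x + (s / infDist x M) • (x - nearestPt M x)) M = infDist x M + s := by
  obtain ⟨y, hyx, hy⟩ := exists_infDist_eq_add hM hne hx0 hs hsr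
  have hx : x ∈ unpp M := hM ((mem_thickening_iff_infDist_lt hne).2 (by linarith))
  have hn := norm_sub_nearestPt hx
  have h1 : infDist x M + s ≤ ‖y - nearestPt M x‖ := hy ▸ infDist_le_norm_sub (nearestPt_mem hx)
  have h2 : ‖y - nearestPt M x‖ ≤ ‖x - nearestPt M x‖ + ‖y - x‖ := by
    have := norm_add_le (x - nearestPt M x) (y - x)
    rwa [show x - nearestPt M x + (y - x) = y - nearestPt M x by abel] at this
  have h3 : ‖(x - nearestPt M x) + (y - x)‖ = ‖x - nearestPt M x‖ + ‖y - x‖ := by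
    rw [show x - nearestPt M x + (y - x) = y - nearestPt M x by abel]
    linarith
  -- Equality in the triangle inequality, with strict convexity of the Euclidean norm, puts `y` on
  -- the ray from the nearest point through `x`.
  have h4 := (sameRay_iff_norm_add.2 h3).norm_smul_eq
  rw [hn, hyx] at h4
  have h5 : y - x = (s / infDist x M) • (x - nearestPt M x) := by
    rw [div_eq_inv_mul, mul_smul, ← h4, smul_smul, inv_mul_cancel₀ hx0.ne', one_smul]
  rw [← h5, add_sub_cancel, hy]

/-- For `x` off `M`, move out along the ray to distance `R = (ε + r) / 2`. The open ball of radius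
`R` about that point misses `M`, and expanding the square in `R ≤ ‖centre - η‖` gives the bound with
factor `δ / (2 * R)`, where `δ < ε`. -/
theorem inner_sub_nearestPt_le (hM : thickening r M ⊆ unpp M) {ε : ℝ} (hε : 0 < ε) (hεr : ε < r)
    {x η : EucSp d} (hx : x ∈ thickening ε M) (hη : η ∈ M) :
    inner ℝ (η - nearestPt M x) (x - nearestPt M x) ≤
      (2 * ε / (ε + r)) / 2 * ‖η - nearestPt M x‖ ^ 2 := by
  have hne : M.Nonempty := ⟨η, hη⟩
  have hxr : x ∈ unpp M := hM (thickening_mono hεr.le M hx)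
  have hxε := (mem_thickening_iff_infDist_lt hne).1 hx
  set p := nearestPt M x with hp
  have hn : ‖x - p‖ = infDist x M := norm_sub_nearestPt hxr
  set δ := infDist x M with hδ
  rcases (show 0 ≤ δ from infDist_nonneg).eq_or_lt with h0 | h0
  · rw [← h0, norm_eq_zero] at hn
    rw [hn, inner_zero_right]
    have : 0 < ε + r := by linarith
    positivity
  · have hR : δ + ((ε + r) / 2 - δ) < r := by linarith
    have h1 := infDist_add_smul hM hne h0 (s := (ε + r) / 2 - δ) (by linarith) hR
    rw [← hδ, ← hp] at h1
    have h2 := infDist_le_norm_sub (x := x + (((ε + r) / 2 - δ) / δ) • (x - p)) hη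
    rw [h1] at h2
    set R := (ε + r) / 2 with hRdef
    have h3 : x + ((R - δ) / δ) • (x - p) - η = (R / δ) • (x - p) - (η - p) := by
      rw [sub_div, div_self h0.ne', sub_smul, one_smul]; abel
    rw [h3] at h2
    have hR0 : 0 < R := by rw [hRdef]; linarith
    have h4 : R ^ 2 ≤ ‖(R / δ) • (x - p) - (η - p)‖ ^ 2 := by
      have : R ≤ ‖(R / δ) • (x - p) - (η - p)‖ := by linarith
      gcongr
    rw [norm_sub_sq_real, norm_smul, hn, real_inner_smul_left, real_inner_comm,
      Real.norm_of_nonneg (by positivity), div_mul_cancel₀ _ h0.ne'] at h4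
    have h5 : inner ℝ (η - p) (x - p) ≤ δ / (2 * R) * ‖η - p‖ ^ 2 := by
      have h6 : R * inner ℝ (η - p) (x - p) * 2 ≤ δ * ‖η - p‖ ^ 2 := by
        have : 2 * (R / δ * inner ℝ (η - p) (x - p)) ≤ ‖η - p‖ ^ 2 := by linarith
        have := mul_le_mul_of_nonneg_left this h0.le
        calc _ = δ * (2 * (R / δ * inner ℝ (η - p) (x - p))) := by field_simp
          _ ≤ _ := this
      rw [div_mul_eq_mul_div, le_div_iff₀ (by positivity)]
      linarith
    refine h5.trans ?_
    have : 2 * ε / (ε + r) / 2 = ε / (2 * R) := by rw [hRdef]; field_simp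
    rw [this]
    gcongr

/-- Add the touching-ball inequalities for `x` and for `y`, each tested at the other's nearest
point, and apply Cauchy–Schwarz. -/
theorem norm_nearestPt_sub_le (hM : thickening r M ⊆ unpp M) {ε : ℝ} (hε : 0 < ε) (hεr : ε < r)
    {x y : EucSp d} (hx : x ∈ thickening ε M) (hy : y ∈ thickening ε M) :
    ‖nearestPt M x - nearestPt M y‖ ≤ (1 - 2 * ε / (ε + r))⁻¹ * ‖x - y‖ := by
  have hx' := nearestPt_mem (hM (thickening_mono hεr.le M hx))
  have hy' := nearestPt_mem (hM (thickening_mono hεr.le M hy))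
  have h1 := inner_sub_nearestPt_le hM hε hεr hx hy'
  have h2 := inner_sub_nearestPt_le hM hε hεr hy hx'
  set p := nearestPt M x
  set q := nearestPt M y
  set θ := 2 * ε / (ε + r) with hθ
  have hθ1 : 0 < 1 - θ := by
    rw [hθ, sub_pos, div_lt_one (by linarith)]; linarith
  have h3 : inner ℝ (q - p) (x - p) + inner ℝ (p - q) (y - q) =
      ‖p - q‖ ^ 2 - inner ℝ (p - q) (x - y) := by
    rw [← real_inner_self_eq_norm_sq, ← neg_sub p q, inner_neg_left]
    have : x - p = (x - y) + (y - q) - (p - q) := by abel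
    rw [this, inner_sub_right, inner_add_right]; ring
  rw [norm_sub_rev q p] at h1
  have h4 : (1 - θ) * ‖p - q‖ ^ 2 ≤ ‖p - q‖ * ‖x - y‖ := by
    have := real_inner_le_norm (p - q) (x - y)
    linarith
  rw [inv_mul_eq_div, le_div_iff₀ hθ1]
  rcases (norm_nonneg (p - q)).eq_or_lt with h0 | h0
  · rw [← h0, zero_mul]; positivity
  · refine le_of_mul_le_mul_left ?_ h0
    linarith

end NearestPoint

/-! ### Tangent vectors as velocities of curves. -/

section TangentSpace

variable {d : ℕ} {M : Set (EucSp d)}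

theorem mem_tangentSp_of_hasDerivAt {γ : ℝ → EucSp d} {s₀ : ℝ} {t : EucSp d}
    (hγ : ContDiffAt ℝ 1 γ s₀) (hM : ∀ᶠ s in 𝓝 s₀, γ s ∈ M) (ht : HasDerivAt γ t s₀) :
    t ∈ tangentSp M (γ s₀) := by
  obtain ⟨δ, hδ, h⟩ := Metric.eventually_nhds_iff_ball.1
    (hM.and (hγ.eventually (by simp)))
  have hmem : ∀ s ∈ Ioo (-1 : ℝ) 1, s₀ + δ * s ∈ ball s₀ δ := by
    intro s hs
    rw [mem_ball, Real.dist_eq, add_sub_cancel_left, abs_mul, abs_of_pos hδ]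
    exact mul_lt_of_lt_one_right hδ (abs_lt.2 hs)
  have hd : HasDerivAt (fun s : ℝ => s₀ + δ * s) δ 0 := by
    simpa using ((hasDerivAt_id (0 : ℝ)).const_mul δ).const_add s₀
  have h1 : δ • t ∈ tangentSp M (γ s₀) := by
    refine Submodule.subset_span ⟨fun s => γ (s₀ + δ * s), fun s hs => ?_, fun s hs => ?_, ?_, ?_⟩
    · have := (h _ (hmem s hs)).2
      exact (ContDiffAt.comp (f := fun s : ℝ => s₀ + δ * s) (g := γ) s this
        (by fun_prop)).contDiffWithinAt
    · exact (h _ (hmem s hs)).1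
    · simp
    · exact HasDerivAt.scomp (g₁ := γ) (h := fun s : ℝ => s₀ + δ * s) 0 (by simpa using ht) hd
  have h2 := (tangentSp M (γ s₀)).smul_mem δ⁻¹ h1
  rwa [smul_smul, inv_mul_cancel₀ hδ.ne', one_smul] at h2

theorem fderiv_apply_mem_tangentSp {F : Type*} [NormedAddCommGroup F] [NormedSpace ℝ F]
    {f : F → EucSp d} {x : F} (hf : ContDiffAt ℝ 1 f x) (hM : ∀ᶠ y in 𝓝 x, f y ∈ M) (h : F) :
    fderiv ℝ f x h ∈ tangentSp M (f x) := by
  have hl : ContDiffAt ℝ 1 (fun s : ℝ => x + s • h) 0 := by fun_prop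
  have h0 : x + (0 : ℝ) • h = x := by simp
  have hd : HasDerivAt (fun s : ℝ => x + s • h) h 0 := by
    simpa using ((hasDerivAt_id (0 : ℝ)).smul_const h).const_add x
  have := mem_tangentSp_of_hasDerivAt (M := M) (γ := fun s : ℝ => f (x + s • h)) (s₀ := 0)
    (t := fderiv ℝ f x h)
    (ContDiffAt.comp (g := f) 0 (by simpa using hf) hl)
    (hl.continuousAt.eventually (by simpa using hM))
    (HasFDerivAt.comp_hasDerivAt (l := f) 0 (by
      simpa using (hf.differentiableAt (by simp)).hasFDerivAt) hd)
  simpa using this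

theorem tangentSp_le {ξ : EucSp d} {S : Submodule ℝ (EucSp d)}
    (h : ∀ (γ : ℝ → EucSp d) (t : EucSp d), (∀ᶠ s in 𝓝 (0 : ℝ), γ s ∈ M) → γ 0 = ξ →
      HasDerivAt γ t 0 → t ∈ S) : tangentSp M ξ ≤ S := by
  refine Submodule.span_le.2 ?_
  rintro t ⟨γ, -, hγM, h0, ht⟩
  exact h γ t (eventually_of_mem (Ioo_mem_nhds (by norm_num) (by norm_num)) hγM) h0 ht

/-- First variation of the squared distance to `x` along curves in `M`. -/
theorem sub_nearestPt_mem_orthogonal {x : EucSp d} (hx : x ∈ unpp M) :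
    x - nearestPt M x ∈ (tangentSp M (nearestPt M x))ᗮ := by
  set p := nearestPt M x with hp
  suffices h : tangentSp M p ≤ (ℝ ∙ (x - p))ᗮ by
    rw [Submodule.mem_orthogonal']
    intro t ht
    exact Submodule.mem_orthogonal_singleton_iff_inner_right.1 (h ht)
  refine tangentSp_le fun γ t hγM h0 ht => ?_
  rw [Submodule.mem_orthogonal_singleton_iff_inner_right]
  have hmin : IsLocalMin (fun s => ‖x - γ s‖ ^ 2) 0 := by
    filter_upwards [hγM] with s hs
    simp only [h0]
    rw [hp, norm_sub_nearestPt hx]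
    exact pow_le_pow_left₀ infDist_nonneg (infDist_le_norm_sub hs) 2
  have h1 := hmin.hasDerivAt_eq_zero ((ht.const_sub x).norm_sq)
  rw [h0, inner_neg_right] at h1
  linarith

/-- Derivatives within `V` are not unique, but the chain rule along curves in `M` fixes their values
on velocities. This makes computations with `tangentialFDeriv` independent of the choice behind
`fderivWithin`. -/
theorem HasFDerivWithinAt.eq_on_tangentSp {F : Type*} [NormedAddCommGroup F] [NormedSpace ℝ F]
    {V : Set (EucSp d)} {f : EucSp d → F} {f₁ f₂ : EucSp d →L[ℝ] F} {ξ : EucSp d}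
    (hV : IsOpenSubset M V) (hξ : ξ ∈ V) (h₁ : HasFDerivWithinAt f f₁ V ξ)
    (h₂ : HasFDerivWithinAt f f₂ V ξ) {t : EucSp d} (ht : t ∈ tangentSp M ξ) : f₁ t = f₂ t := by
  obtain ⟨U, hU, rfl⟩ := hV
  suffices h : tangentSp M ξ ≤ LinearMap.eqLocus (f₁ : EucSp d →ₗ[ℝ] F) (f₂ : EucSp d →ₗ[ℝ] F) from
    h ht
  refine tangentSp_le fun γ t hγM h0 ht => ?_
  have hin : ∀ᶠ s in 𝓝 (0 : ℝ), γ s ∈ M ∩ U :=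
    hγM.and (ht.continuousAt.eventually (by rw [h0]; exact hU.mem_nhds hξ.2))
  have key : ∀ f' : EucSp d →L[ℝ] F, HasFDerivWithinAt f f' (M ∩ U) ξ →
      HasDerivAt (f ∘ γ) (f' t) 0 := fun f' hf' =>
    HasFDerivWithinAt.comp_hasDerivAt_of_eq (t := M ∩ U) 0 hf' ht hin h0.symm
  exact (key _ h₁).unique (key _ h₂)

end TangentSpace

/-! ### Local retractions onto the submanifold and the dimension of its tangent spaces. -/

section Retraction

variable {d k m : ℕ} {M : Set (EucSp d)}

/-- The projection of `ℝ^d` onto the first `m` coordinates. -/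
noncomputable def coordProj (d m : ℕ) : EucSp d →L[ℝ] EucSp d :=
  Matrix.toEuclideanCLM (n := Fin d) (𝕜 := ℝ)
    (Matrix.diagonal fun i : Fin d => if (i : ℕ) < m then 1 else 0)

theorem coordProj_apply (y : EucSp d) (i : Fin d) :
    coordProj d m y i = if (i : ℕ) < m then y i else 0 := by
  simp [coordProj, Matrix.ofLp_toEuclideanCLM, Matrix.mulVec_diagonal]

theorem finrank_range_coordProj (h : m ≤ d) :
    Module.finrank ℝ (LinearMap.range (coordProj d m : EucSp d →ₗ[ℝ] EucSp d)) = m := by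
  have h1 : (coordProj d m : EucSp d →ₗ[ℝ] EucSp d) = Matrix.toLin
      (PiLp.basisFun 2 ℝ (Fin d)) (PiLp.basisFun 2 ℝ (Fin d))
      (Matrix.diagonal fun i : Fin d => if (i : ℕ) < m then 1 else 0) := by
    rw [coordProj, Matrix.coe_toEuclideanCLM_eq_toEuclideanLin]
    exact LinearEquiv.congr_fun (Matrix.toLpLin_eq_toLin 2 2) _
  rw [h1, ← Matrix.rank_eq_finrank_range_toLin, Matrix.rank_diagonal]
  simp only [ne_eq, ite_eq_right_iff, one_ne_zero, imp_false, not_not]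
  rw [Fintype.card_subtype]
  rw [Fin.card_filter_val_lt, min_eq_right h]

/-- Near each of its points, a `C^k` submanifold is a `C^k` neighbourhood retract. -/
theorem IsSubmanifold.exists_retraction_finrank (hM : IsSubmanifold k m M) (hk : 1 ≤ k)
    {ξ : EucSp d} (hξ : ξ ∈ M) : ∃ (U : Set (EucSp d)) (ρ : EucSp d → EucSp d), IsOpen U ∧ ξ ∈ U ∧
      ContDiffOn ℝ k ρ U ∧ (∀ ζ ∈ U, ρ ζ ∈ M) ∧ (∀ η ∈ U ∩ M, ρ η = η) ∧
      Module.finrank ℝ (LinearMap.range (fderiv ℝ ρ ξ : EucSp d →ₗ[ℝ] EucSp d)) = m := by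
  obtain ⟨hmd, hM⟩ := hM
  obtain ⟨Ψ, hξt, hΨ, hΨs, hiff⟩ := hM ξ hξ
  have hk0 : (k : WithTop ℕ∞) ≠ 0 := by
    simpa using (show k ≠ 0 by omega)
  have hfix : ∀ η ∈ Ψ.target, η ∈ M → coordProj d m (Ψ.symm η) = Ψ.symm η := by
    intro η hη hηM
    have h := (hiff _ (Ψ.map_target hη)).1 (by rwa [Ψ.right_inv hη])
    ext i
    rw [coordProj_apply]
    split_ifs with hi
    · rfl
    · exact (h i (not_lt.1 hi)).symm
  have hcont : ContinuousOn (fun ζ => coordProj d m (Ψ.symm ζ)) Ψ.target :=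
    (coordProj d m).continuous.comp_continuousOn Ψ.symm.continuousOn
  set U := Ψ.target ∩ (fun ζ => coordProj d m (Ψ.symm ζ)) ⁻¹' Ψ.source with hU
  have hUo : IsOpen U := hcont.isOpen_inter_preimage Ψ.open_target Ψ.open_source
  have hξU : ξ ∈ U := ⟨hξt, by
    simp only [mem_preimage]; rw [hfix ξ hξt hξ]; exact Ψ.map_target hξt⟩
  refine ⟨U, fun ζ => Ψ (coordProj d m (Ψ.symm ζ)), hUo, hξU, ?_, ?_, ?_, ?_⟩
  · refine hΨ.comp (t := Ψ.source) ((coordProj d m).contDiff.comp_contDiffOn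
      (hΨs.mono inter_subset_left)) fun ζ hζ => hζ.2
  · intro ζ hζ
    refine (hiff _ hζ.2).2 fun i hi => ?_
    rw [coordProj_apply, if_neg (not_lt.2 hi)]
  · intro η hη
    simp only
    rw [hfix η hη.1.1 hη.2, Ψ.right_inv hη.1.1]
  -- The derivative of the retraction at `ξ` is the coordinate projection conjugated by the
  -- invertible derivative of the chart, so it has rank `m`.
  · have hy0 : Ψ.symm ξ ∈ Ψ.source := Ψ.map_target hξt
    have d1 : HasFDerivAt Ψ.symm (fderiv ℝ Ψ.symm ξ) ξ :=
      ((hΨs.contDiffAt (Ψ.open_target.mem_nhds hξt)).differentiableAt hk0).hasFDerivAt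
    have d2 : HasFDerivAt Ψ (fderiv ℝ Ψ (Ψ.symm ξ)) (Ψ.symm ξ) :=
      ((hΨ.contDiffAt (Ψ.open_source.mem_nhds hy0)).differentiableAt hk0).hasFDerivAt
    set A := fderiv ℝ Ψ (Ψ.symm ξ)
    set B := fderiv ℝ Ψ.symm ξ
    have hAB : A.comp B = ContinuousLinearMap.id ℝ _ := by
      refine (d2.comp ξ d1).unique ((hasFDerivAt_id ξ).congr_of_eventuallyEq ?_)
      filter_upwards [Ψ.open_target.mem_nhds hξt] with ζ hζ
      exact Ψ.right_inv hζ
    have hAB' : (A : EucSp d →ₗ[ℝ] EucSp d) ∘ₗ (B : EucSp d →ₗ[ℝ] EucSp d) = LinearMap.id := by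
      ext1 v; exact DFunLike.congr_fun hAB v
    have hBA' : (B : EucSp d →ₗ[ℝ] EucSp d) ∘ₗ (A : EucSp d →ₗ[ℝ] EucSp d) = LinearMap.id :=
      mul_eq_one_comm.1 hAB'
    let e : EucSp d ≃ₗ[ℝ] EucSp d := LinearEquiv.ofLinearMap _ _ hAB' hBA'
    have d3 : HasFDerivAt (fun ζ => Ψ (coordProj d m (Ψ.symm ζ)))
        (A.comp ((coordProj d m).comp B)) ξ := by
      refine HasFDerivAt.comp ξ (g := Ψ) ?_ ((coordProj d m).hasFDerivAt.comp ξ d1)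
      rwa [hfix ξ hξt hξ]
    rw [d3.fderiv]
    have : ((A.comp ((coordProj d m).comp B) : EucSp d →L[ℝ] EucSp d) : EucSp d →ₗ[ℝ] EucSp d) =
      (e : EucSp d →ₗ[ℝ] EucSp d) ∘ₗ (coordProj d m : EucSp d →ₗ[ℝ] EucSp d) ∘ₗ
        (e.symm : EucSp d →ₗ[ℝ] EucSp d) := rfl
    rw [this, LinearMap.range_comp, LinearMap.range_comp, LinearEquiv.range, Submodule.map_top]
    rw [LinearEquiv.finrank_map_eq e, finrank_range_coordProj hmd.le]

theorem IsSubmanifold.exists_retraction (hM : IsSubmanifold k m M) (hk : 1 ≤ k)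
    {ξ : EucSp d} (hξ : ξ ∈ M) : ∃ (U : Set (EucSp d)) (ρ : EucSp d → EucSp d), IsOpen U ∧ ξ ∈ U ∧
      ContDiffOn ℝ k ρ U ∧ (∀ ζ ∈ U, ρ ζ ∈ M) ∧ (∀ η ∈ U ∩ M, ρ η = η) := by
  obtain ⟨U, ρ, h⟩ := hM.exists_retraction_finrank hk hξ
  exact ⟨U, ρ, h.1, h.2.1, h.2.2.1, h.2.2.2.1, h.2.2.2.2.1⟩

/-- The derivative of a retraction onto `M` is the identity on tangent vectors. -/
theorem fderiv_retraction_apply {U : Set (EucSp d)} {ρ : EucSp d → EucSp d} (hU : IsOpen U)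
    (hρM : ∀ η ∈ U ∩ M, ρ η = η) {ξ : EucSp d} (hξ : ξ ∈ U ∩ M) (hρ : DifferentiableAt ℝ ρ ξ)
    {t : EucSp d} (ht : t ∈ tangentSp M ξ) : fderiv ℝ ρ ξ t = t := by
  refine HasFDerivWithinAt.eq_on_tangentSp (V := M ∩ U) (f := ρ)
    (f₂ := ContinuousLinearMap.id ℝ _) ⟨U, hU, rfl⟩ ⟨hξ.2, hξ.1⟩
    hρ.hasFDerivAt.hasFDerivWithinAt ?_ ht
  exact (hasFDerivWithinAt_id ξ _).congr (fun η hη => hρM η ⟨hη.2, hη.1⟩) (hρM ξ hξ)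

/-- The tangent space is the range of the derivative of the retraction: that derivative fixes
tangent vectors and takes only tangent values. -/
theorem IsSubmanifold.finrank_tangentSp (hM : IsSubmanifold k m M) (hk : 1 ≤ k)
    {ξ : EucSp d} (hξ : ξ ∈ M) : Module.finrank ℝ (tangentSp M ξ) = m := by
  obtain ⟨U, ρ, hU, hξU, hρ, hρU, hρM, hrank⟩ := hM.exists_retraction_finrank hk hξ
  have hρ1 : ContDiffAt ℝ 1 ρ ξ := (hρ.contDiffAt (hU.mem_nhds hξU)).of_le (by exact_mod_cast hk)
  suffices h : tangentSp M ξ = LinearMap.range (fderiv ℝ ρ ξ : EucSp d →ₗ[ℝ] EucSp d) by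
    rw [h, hrank]
  refine le_antisymm (fun t ht => ⟨t, fderiv_retraction_apply hU hρM ⟨hξU, hξ⟩
    (hρ1.differentiableAt (by simp)) ht⟩) ?_
  rintro _ ⟨h, rfl⟩
  have := fderiv_apply_mem_tangentSp hρ1 (eventually_of_mem (hU.mem_nhds hξU) hρU) h
  rwa [hρM ξ ⟨hξU, hξ⟩] at this

end Retraction

/-! ### Normal projections in terms of orthonormal frames. -/

section Frames

variable {d m N : ℕ} {M : Set (EucSp d)}

/-- The operator `x ↦ ∑ l, ⟪v l, x⟫ v l`. -/
noncomputable def frameProj (v : Fin N → EucSp d) : EucSp d →L[ℝ] EucSp d :=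
  ∑ l, (innerSL ℝ (v l)).smulRight (v l)

theorem frameProj_apply (v : Fin N → EucSp d) (x : EucSp d) :
    frameProj v x = ∑ l, inner ℝ (v l) x • v l := by
  simp [frameProj]

theorem starProjection_eq_one_sub_frameProj {S : Submodule ℝ (EucSp d)}
    (hS : Module.finrank ℝ S = m) {v : Fin (d - m) → EucSp d} (hv : Orthonormal ℝ v)
    (hvS : ∀ l, v l ∈ Sᗮ) : S.starProjection = 1 - frameProj v := by
  have hspan : Submodule.span ℝ (range v) = Sᗮ := by
    refine Submodule.eq_of_le_of_finrank_eq (Submodule.span_le.2 (by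
      rintro _ ⟨l, rfl⟩; exact hvS l)) ?_
    rw [finrank_span_eq_card hv.linearIndependent, Fintype.card_fin]
    have := S.finrank_add_finrank_orthogonal
    rw [hS, finrank_euclideanSpace, Fintype.card_fin] at this
    omega
  ext1 x
  refine Submodule.eq_starProjection_of_mem_orthogonal ?_ ?_
  · rw [← Submodule.orthogonal_orthogonal S, ← hspan, Submodule.mem_orthogonal]
    intro u hu
    induction hu using Submodule.span_induction with
    | mem u hu =>
      obtain ⟨l, rfl⟩ := hu
      simp [frameProj_apply, inner_sub_right, inner_sum, inner_smul_right,
        orthonormal_iff_ite.1 hv]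
    | zero => simp
    | add a b _ _ ha hb => rw [inner_add_left, ha, hb, add_zero]
    | smul c a _ ha => rw [inner_smul_left, ha, mul_zero]
  · simp only [sub_apply, one_apply_eq_self, sub_sub_cancel,
      frameProj_apply]
    exact Submodule.sum_mem _ fun l _ => Submodule.smul_mem _ _ (hvS l)

theorem ContDiffOn.frameProj {F : Type*} [NormedAddCommGroup F] [NormedSpace ℝ F]
    {n : WithTop ℕ∞} {s : Set F} {v : Fin N → F → EucSp d} (hv : ∀ l, ContDiffOn ℝ n (v l) s) :
    ContDiffOn ℝ n (fun x => frameProj fun l => v l x) s := by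
  unfold _root_.frameProj
  refine ContDiffOn.sum fun l _ => ContDiffOn.smulRight ?_ (hv l)
  exact (innerSL ℝ).contDiff.comp_contDiffOn (hv l)

end Frames

/-! ### Second variation at a touching ball. -/

section SecondVariation

/-- A positive second derivative would make `a` a local minimum too, so `g` would be locally
constant. -/
theorem deriv_deriv_nonpos_of_isLocalMax {g : ℝ → ℝ} {a : ℝ} (h : IsLocalMax g a)
    (hc : ContinuousAt g a) : deriv (deriv g) a ≤ 0 := by
  by_contra! hpos
  have hmin := isLocalMin_of_deriv_deriv_pos hpos h.deriv_eq_zero hc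
  have hconst : g =ᶠ[𝓝 a] fun _ => g a := by
    filter_upwards [h, hmin] with s h1 h2 using le_antisymm h1 h2
  have h1 : deriv g =ᶠ[𝓝 a] fun _ => 0 := by
    simpa using hconst.deriv
  rw [h1.deriv_eq] at hpos
  simp at hpos

variable {d : ℕ} {M : Set (EucSp d)}

/-- If `M` stays outside of a ball touching it at `ξ`, then the second fundamental form in the
direction of the centre of the ball is bounded. -/
theorem neg_inner_fderiv_le {U : Set (EucSp d)} {ρ : EucSp d → EucSp d} {ξ v τ : EucSp d}
    {q : EucSp d → EucSp d →L[ℝ] EucSp d} {q' : EucSp d →L[ℝ] EucSp d →L[ℝ] EucSp d} {θ : ℝ}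
    (hU : IsOpen U) (hξ : ξ ∈ U) (hρ : ContDiffOn ℝ 2 ρ U) (hρM : ∀ ζ ∈ U, ρ ζ ∈ M)
    (hρξ : ρ ξ = ξ) (hq : HasFDerivAt q q' ξ)
    (hqT : ∀ ζ ∈ U, (tangentSp M (ρ ζ)).starProjection = 1 - q ζ)
    (hv : v ∈ (tangentSp M ξ)ᗮ)
    (hball : ∀ η ∈ M, inner ℝ (η - ξ) v ≤ θ / 2 * ‖η - ξ‖ ^ 2) (hτ : fderiv ℝ ρ ξ τ = τ) :
    -inner ℝ τ (q' τ v) ≤ θ * ‖τ‖ ^ 2 := by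
  set c : ℝ → EucSp d := fun s => ξ + s • τ with hc
  have hc0 : c 0 = ξ := by simp [hc]
  have hcd : ∀ s, HasDerivAt c τ s := fun s => by
    simpa [hc] using ((hasDerivAt_id s).smul_const τ).const_add ξ
  have hcU : ∀ᶠ s in 𝓝 (0 : ℝ), c s ∈ U :=
    (hcd 0).continuousAt.eventually (by rw [hc0]; exact hU.mem_nhds hξ)
  have hρd : ∀ ζ ∈ U, HasFDerivAt ρ (fderiv ℝ ρ ζ) ζ := fun ζ hζ =>
    ((hρ.contDiffAt (hU.mem_nhds hζ)).differentiableAt (by simp)).hasFDerivAt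
  set g : ℝ → ℝ := fun s => inner ℝ (ρ (c s) - ξ) v - θ / 2 * ‖ρ (c s) - ξ‖ ^ 2 with hg
  -- This is `g'`, with the normal part `q (c s) v` removed at no cost because the velocity is
  -- tangent. The right factor now vanishes at `s = 0`, so the second derivative of `ρ` drops out of
  -- `φ' 0`.
  set φ : ℝ → ℝ := fun s => inner ℝ (fderiv ℝ ρ (c s) τ)
    (v - q (c s) v - θ • (ρ (c s) - ξ)) with hφ
  have hρc : ∀ s, c s ∈ U → HasDerivAt (fun s => ρ (c s)) (fderiv ℝ ρ (c s) τ) s := fun s hs =>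
    (hρd _ hs).comp_hasDerivAt s (hcd s)
  have hgd : ∀ s, c s ∈ U → HasDerivAt g (φ s) s := by
    intro s hs
    have h1 := (hρc s hs).sub_const ξ
    have h2 := (h1.inner ℝ (hasDerivAt_const s v)).sub (h1.norm_sq.const_mul (θ / 2))
    refine h2.congr_deriv ?_
    have hT : fderiv ℝ ρ (c s) τ ∈ tangentSp M (ρ (c s)) :=
      fderiv_apply_mem_tangentSp ((hρ.contDiffAt (hU.mem_nhds hs)).of_le (by norm_num))
        (eventually_of_mem (hU.mem_nhds hs) hρM) τ
    have hqv : q (c s) v = v - (tangentSp M (ρ (c s))).starProjection v := by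
      rw [hqT _ hs]; simp
    have h3 : inner ℝ (fderiv ℝ ρ (c s) τ) (q (c s) v) = 0 := by
      rw [hqv]
      exact Submodule.inner_right_of_mem_orthogonal hT
        (Submodule.sub_starProjection_mem_orthogonal v)
    simp only [hφ, inner_sub_right, inner_smul_right, h3, inner_zero_right,
      real_inner_comm (fderiv ℝ ρ (c s) τ)]
    ring
  have hmax : IsLocalMax g 0 := by
    filter_upwards [hcU] with s hs
    have : g 0 = 0 := by simp [hg, hc0, hρξ]
    rw [this]
    have := hball _ (hρM _ hs)
    simp only [hg]
    linarith
  have hdd := deriv_deriv_nonpos_of_isLocalMax hmax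
    (hgd 0 (by rwa [hc0])).continuousAt
  have hdg : deriv g =ᶠ[𝓝 0] φ := hcU.mono fun s hs => (hgd s hs).deriv
  have hqv0 : q ξ v = v := by
    have h1 : (tangentSp M ξ).starProjection v = 0 :=
      (Submodule.starProjection_apply_eq_zero_iff _).2 hv
    have h2 := hqT ξ hξ
    rw [hρξ] at h2
    rw [h2] at h1
    exact (sub_eq_zero.1 h1).symm
  have hρ2 : DifferentiableAt ℝ (fderiv ℝ ρ) (c 0) := by
    rw [hc0]
    exact ((hρ.contDiffAt (hU.mem_nhds hξ)).fderiv_right (m := 1) (by norm_num)).differentiableAt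
      (by simp)
  have hρ'c : HasDerivAt (fun s => fderiv ℝ ρ (c s) τ) (fderiv ℝ (fderiv ℝ ρ) (c 0) τ τ) 0 := by
    have h1 := hρ2.hasFDerivAt.comp_hasDerivAt 0 (hcd 0)
    simpa using h1.clm_apply (hasDerivAt_const 0 τ)
  have hqc : HasDerivAt (fun s => q (c s) v) (q' τ v) 0 := by
    have h1 := HasFDerivAt.comp_hasDerivAt (l := q) (l' := q') 0 (by rwa [hc0]) (hcd 0)
    simpa using h1.clm_apply (hasDerivAt_const 0 v)
  have hφd : HasDerivAt φ (-inner ℝ τ (q' τ v) - θ * ‖τ‖ ^ 2) 0 := by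
    have h1 := hρ'c.inner ℝ (((hasDerivAt_const 0 v).sub hqc).sub
      (((hρc 0 (by rwa [hc0])).sub_const ξ).const_smul θ))
    refine h1.congr_deriv ?_
    simp [hc0, hρξ, hqv0, hτ, inner_sub_right, inner_smul_right]
  rw [hdg.deriv_eq, hφd.deriv] at hdd
  linarith

end SecondVariation

/-! ### Smoothness of the nearest point map by the implicit function theorem. -/

section Regularity

variable {d k : ℕ} {M : Set (EucSp d)}

theorem IsSubmanifold.contDiffAt_nearestPt {m N : ℕ} {r ε : ℝ} (hsub : IsSubmanifold k m M)
    (hk : 2 ≤ k) (hM : thickening r M ⊆ unpp M) (hε : 0 < ε) (hεr : ε < r) {x : EucSp d}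
    (hx : x ∈ thickening ε M) {V : Set (EucSp d)} (hV : IsOpenSubset M V) (hxV : nearestPt M x ∈ V)
    {n : Fin N → EucSp d → EucSp d} (hn : ∀ l, ContDiffOn ℝ (k - 1 : ℕ) (n l) V)
    (hnT : ∀ η ∈ V, (tangentSp M η).starProjection = 1 - frameProj fun l => n l η) :
    ContDiffAt ℝ (k - 1 : ℕ) (nearestPt M) x := by
  have hxr := thickening_mono hεr.le M hx
  have hxu := hM hxr
  set ξ := nearestPt M x with hξ
  have hξM : ξ ∈ M := nearestPt_mem hxu
  obtain ⟨O, hO, rfl⟩ := hV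
  obtain ⟨U₀, ρ, hU₀, hξU₀, hρ, hρU, hρM⟩ := hsub.exists_retraction (by omega) hξM
  have hρξ : ρ ξ = ξ := hρM ξ ⟨hξU₀, hξM⟩
  set U := U₀ ∩ ρ ⁻¹' O with hUdef
  have hU : IsOpen U := hρ.continuousOn.isOpen_inter_preimage hU₀ hO
  have hξU : ξ ∈ U := ⟨hξU₀, by rw [mem_preimage, hρξ]; exact hxV.2⟩
  have hρ' : ContDiffOn ℝ k ρ U := hρ.mono inter_subset_left
  have hk1 : ((k - 1 : ℕ) : WithTop ℕ∞) ≤ k := by exact_mod_cast Nat.sub_le k 1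
  have hk0 : ((k - 1 : ℕ) : WithTop ℕ∞) ≠ 0 := by
    have : k - 1 ≠ 0 := by omega
    exact_mod_cast this
  have hρV : MapsTo ρ U (M ∩ O) := fun ζ hζ => ⟨hρU ζ hζ.1, hζ.2⟩
  set q : EucSp d → EucSp d →L[ℝ] EucSp d := fun ζ => frameProj fun l => n l (ρ ζ) with hq
  have hqc : ContDiffOn ℝ (k - 1 : ℕ) q U :=
    ContDiffOn.frameProj fun l => (hn l).comp (hρ'.of_le hk1) hρV
  have hqT : ∀ ζ ∈ U, (tangentSp M (ρ ζ)).starProjection = 1 - q ζ := fun ζ hζ => hnT _ (hρV hζ)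
  set P := (tangentSp M ξ).starProjection with hP
  have hPq : P = 1 - q ξ := by rw [hP, ← hqT ξ hξU, hρξ]
  -- One equation in `ℝ^d` for both conditions on `z.2`: lying on `M`, and `z.1 - z.2` being normal
  -- there. The outer fixed `P` forces kernel vectors of the partial derivative to be tangent at
  -- `ξ`.
  set H : EucSp d × EucSp d → EucSp d := fun z =>
    z.2 - ρ z.2 - P ((1 - q z.2) (z.1 - ρ z.2)) with hH
  have hρa : ContDiffAt ℝ k ρ ξ := hρ'.contDiffAt (hU.mem_nhds hξU)
  have hqa : ContDiffAt ℝ (k - 1 : ℕ) q ξ := hqc.contDiffAt (hU.mem_nhds hξU)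
  have hHc : ContDiffAt ℝ (k - 1 : ℕ) H (x, ξ) := by
    have h1 : ContDiffAt ℝ (k - 1 : ℕ) (fun z : EucSp d × EucSp d => ρ z.2) (x, ξ) :=
      ContDiffAt.comp (x, ξ) (g := ρ) (hρa.of_le hk1) contDiffAt_snd
    have h2 : ContDiffAt ℝ (k - 1 : ℕ) (fun z : EucSp d × EucSp d => q z.2) (x, ξ) :=
      ContDiffAt.comp (x, ξ) (g := q) hqa contDiffAt_snd
    exact (contDiffAt_snd.sub h1).sub (P.contDiff.contDiffAt.comp (x, ξ)
      ((contDiffAt_const.sub h2).clm_apply (contDiffAt_fst.sub h1)))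
  have hρd := (hρa.differentiableAt (by
    have : k ≠ 0 := by omega
    exact_mod_cast this)).hasFDerivAt
  have hqd := (hqa.differentiableAt hk0).hasFDerivAt
  set ρ' := fderiv ℝ ρ ξ with hρ'def
  set q' := fderiv ℝ q ξ with hq'def
  set θ := 2 * ε / (ε + r) with hθ
  have hθ1 : θ < 1 := by rw [hθ, div_lt_one (by linarith)]; linarith
  have hTρ : ∀ h, ρ' h ∈ tangentSp M ξ := fun h => by
    have := fderiv_apply_mem_tangentSp (hρa.of_le (by exact_mod_cast (by omega : 1 ≤ k)))
      (eventually_of_mem (hU.mem_nhds hξU) fun ζ hζ => hρU ζ hζ.1) h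
    rwa [hρξ] at this
  have hpart : ∀ τ, fderiv ℝ H (x, ξ) (0, τ) = τ + P (q' τ (x - ξ)) := by
    intro τ
    have h1 : HasFDerivAt H (fderiv ℝ H (x, ξ)) (x, ξ) := (hHc.differentiableAt hk0).hasFDerivAt
    have h2 := h1.comp ξ (hasFDerivAt_prodMk_right x ξ)
    have h3 : HasFDerivAt (fun ζ => ζ - ρ ζ - P ((1 - q ζ) (x - ρ ζ))) _ ξ :=
      ((hasFDerivAt_id ξ).sub hρd).sub (P.hasFDerivAt.comp ξ
        (((hasFDerivAt_const (1 : EucSp d →L[ℝ] EucSp d) ξ).sub hqd).clm_apply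
          ((hasFDerivAt_const x ξ).sub hρd)))
    have h4 := DFunLike.congr_fun (h2.unique h3) τ
    have h5 : P (ρ' τ) = ρ' τ := Submodule.starProjection_eq_self_iff.2 (hTρ τ)
    have h6 : fderiv ℝ H (x, ξ) (0, τ) = τ - ρ' τ - P (-P (ρ' τ) - q' τ (x - ξ)) := by
      refine Eq.trans ?_ (h4.trans ?_)
      · simp
      · simp [hPq, hρξ]; abel
    rw [h6, map_sub, map_neg, h5, h5]
    abel
  -- A kernel vector `τ` is tangent with `⟪τ, q' τ (x - ξ)⟫ = -‖τ‖ ^ 2`. The second variation then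
  -- gives `‖τ‖ ^ 2 ≤ θ * ‖τ‖ ^ 2` with `θ < 1`, so `τ = 0`.
  have hinv : (fderiv ℝ H (x, ξ) ∘L .inr ℝ (EucSp d) (EucSp d)).IsInvertible := by
    have hinj : Function.Injective (fderiv ℝ H (x, ξ) ∘L .inr ℝ (EucSp d) (EucSp d)) := by
      rw [injective_iff_map_eq_zero]
      intro τ hτ
      have h1 : τ + P (q' τ (x - ξ)) = 0 := by rw [← hpart τ]; exact hτ
      have h2 : τ = -P (q' τ (x - ξ)) := eq_neg_of_add_eq_zero_left h1
      have hτT : τ ∈ tangentSp M ξ := by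
        rw [h2]; exact Submodule.neg_mem _ (Submodule.starProjection_apply_mem _ _)
      have h3 := neg_inner_fderiv_le (θ := θ) hU hξU (hρ'.of_le (by exact_mod_cast hk))
        (fun ζ hζ => hρU ζ hζ.1) hρξ hqd hqT (sub_nearestPt_mem_orthogonal hxu)
        (fun η hη => inner_sub_nearestPt_le hM hε hεr hx hη)
        (fderiv_retraction_apply hU₀ hρM ⟨hξU₀, hξM⟩ hρd.differentiableAt hτT)
      have h4 : inner ℝ τ (q' τ (x - ξ)) = -‖τ‖ ^ 2 := by
        have h5 : P τ = τ := Submodule.starProjection_eq_self_iff.2 hτT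
        rw [← h5, Submodule.inner_starProjection_left_eq_right, h5,
          show P (q' τ (x - ξ)) = -τ by rw [eq_neg_iff_add_eq_zero, add_comm]; exact h1,
          inner_neg_right, real_inner_self_eq_norm_sq]
      rw [← hξ, h4, neg_neg] at h3
      have h6 : ‖τ‖ ^ 2 ≤ 0 := by nlinarith [sq_nonneg ‖τ‖]
      simpa using h6
    exact ⟨(LinearEquiv.ofInjectiveEndo _ hinj).toContinuousLinearEquiv, by ext; rfl⟩
  refine (hHc.contDiffAt_implicitFunction hk0 hinv).congr_of_eventuallyEq ?_
  -- Continuity keeps `(y, nearestPt M y)` in the region where the implicit function gives the only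
  -- solution.
  have hpc := continuousAt_nearestPt hM hxr
  have hpair : Tendsto (fun y => (y, nearestPt M y)) (𝓝 x) (𝓝 (x, ξ)) :=
    tendsto_id.prodMk_nhds hpc
  have hH0 : ∀ y ∈ thickening r M, nearestPt M y ∈ U → H (y, nearestPt M y) = 0 := by
    intro y hy hyU
    have h1 : ρ (nearestPt M y) = nearestPt M y := hρM _ ⟨hyU.1, nearestPt_mem (hM hy)⟩
    have h2 := hqT _ hyU
    rw [h1] at h2
    simp only [hH, h1]
    rw [← h2, (Submodule.starProjection_apply_eq_zero_iff _).2
      (sub_nearestPt_mem_orthogonal (hM hy))]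
    simp
  filter_upwards [hpair.eventually (hHc.eventually_apply_eq_iff_implicitFunction hk0 hinv),
    isOpen_thickening.mem_nhds hxr, hpc.eventually (hU.mem_nhds hξU)] with y h1 h2 h3
  rw [hH0 y h2 h3, hH0 x hxr hξU] at h1
  exact (h1.1 rfl).symm

end Regularity

/-! ### Calculus of families with uniformly bounded derivatives. -/

section UniformBounds

variable {ι : Type*} {E : Type*} [NormedAddCommGroup E] [NormedSpace ℝ E]
  {F : Type*} [NormedAddCommGroup F] [NormedSpace ℝ F]
  {G : Type*} [NormedAddCommGroup G] [NormedSpace ℝ G]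
  {H : Type*} [NormedAddCommGroup H] [NormedSpace ℝ H]
  {Ω : ι → Set E} {j : ℕ}

/-- The maps `f a` are `C^j` on `Ω a`, and their derivatives up to order `j` are bounded there by a
constant that does not depend on `a`. -/
structure UnifBdd (Ω : ι → Set E) (j : ℕ) (f : ι → E → F) : Prop where
  contDiffOn : ∀ a, ContDiffOn ℝ j (f a) (Ω a)
  bound : ∃ C, ∀ a, ∀ x ∈ Ω a, ∀ l ≤ j, ‖iteratedFDeriv ℝ l (f a) x‖ ≤ C

namespace UnifBdd

theorem mono {f : ι → E → F} {i : ℕ} (h : UnifBdd Ω j f) (hij : i ≤ j) : UnifBdd Ω i f :=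
  ⟨fun a => (h.contDiffOn a).of_le (by exact_mod_cast hij),
    h.bound.imp fun _ hC a x hx l hl => hC a x hx l (hl.trans hij)⟩

theorem zero {f : ι → E → F} (hc : ∀ a, ContinuousOn (f a) (Ω a)) {C : ℝ}
    (hC : ∀ a, ∀ x ∈ Ω a, ‖f a x‖ ≤ C) : UnifBdd Ω 0 f :=
  ⟨fun a => by simpa using hc a, C, fun a x hx l hl => by
    obtain rfl := Nat.le_zero.1 hl
    rw [norm_iteratedFDeriv_zero]; exact hC a x hx⟩

theorem congr (hΩ : ∀ a, IsOpen (Ω a)) {f g : ι → E → F} (h : UnifBdd Ω j f)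
    (hfg : ∀ a, ∀ x ∈ Ω a, g a x = f a x) : UnifBdd Ω j g := by
  refine ⟨fun a => (h.contDiffOn a).congr (hfg a), h.bound.imp fun C hC a x hx l hl => ?_⟩
  have : g a =ᶠ[𝓝 x] f a := eventually_of_mem ((hΩ a).mem_nhds hx) (hfg a)
  rw [(this.iteratedFDeriv ℝ l).eq_of_nhds]
  exact hC a x hx l hl

theorem contDiffAt (hΩ : ∀ a, IsOpen (Ω a)) {f : ι → E → F} (h : UnifBdd Ω j f) {a : ι} {x : E}
    (hx : x ∈ Ω a) {l : ℕ} (hl : l ≤ j) : ContDiffAt ℝ l (f a) x :=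
  ((h.contDiffOn a).contDiffAt ((hΩ a).mem_nhds hx)).of_le (by exact_mod_cast hl)

theorem clm_comp (hΩ : ∀ a, IsOpen (Ω a)) {f : ι → E → F} (h : UnifBdd Ω j f) (L : F →L[ℝ] G) :
    UnifBdd Ω j fun a x => L (f a x) := by
  obtain ⟨C, hC⟩ := h.bound
  refine ⟨fun a => L.contDiff.comp_contDiffOn (h.contDiffOn a), ‖L‖ * C, fun a x hx l hl => ?_⟩
  refine (L.norm_iteratedFDeriv_comp_left (h.contDiffAt hΩ hx hl) le_rfl).trans ?_
  gcongr
  exact hC a x hx l hl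

theorem isometryEquiv_comp (hΩ : ∀ a, IsOpen (Ω a)) {f : ι → E → F} (h : UnifBdd Ω j f)
    (e : F ≃ₗᵢ[ℝ] G) : UnifBdd Ω j fun a x => e (f a x) :=
  h.clm_comp hΩ (e.toContinuousLinearEquiv : F →L[ℝ] G)

theorem add (hΩ : ∀ a, IsOpen (Ω a)) {f g : ι → E → F} (hf : UnifBdd Ω j f) (hg : UnifBdd Ω j g) :
    UnifBdd Ω j fun a x => f a x + g a x := by
  obtain ⟨C, hC⟩ := hf.bound
  obtain ⟨C', hC'⟩ := hg.bound
  refine ⟨fun a => (hf.contDiffOn a).add (hg.contDiffOn a), C + C', fun a x hx l hl => ?_⟩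
  have : iteratedFDeriv ℝ l (fun x => f a x + g a x) x =
      iteratedFDeriv ℝ l (f a) x + iteratedFDeriv ℝ l (g a) x :=
    iteratedFDeriv_add_apply (hf.contDiffAt hΩ hx hl) (hg.contDiffAt hΩ hx hl)
  rw [this]
  exact (norm_add_le _ _).trans (add_le_add (hC a x hx l hl) (hC' a x hx l hl))

theorem neg (hΩ : ∀ a, IsOpen (Ω a)) {f : ι → E → F} (hf : UnifBdd Ω j f) :
    UnifBdd Ω j fun a x => -f a x := by
  simpa using hf.clm_comp hΩ (-ContinuousLinearMap.id ℝ F)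

theorem sub (hΩ : ∀ a, IsOpen (Ω a)) {f g : ι → E → F} (hf : UnifBdd Ω j f) (hg : UnifBdd Ω j g) :
    UnifBdd Ω j fun a x => f a x - g a x := by
  simpa [sub_eq_add_neg] using hf.add hΩ (hg.neg hΩ)

theorem const (c : F) : UnifBdd Ω j fun _ _ => c := by
  refine ⟨fun a => contDiffOn_const, ‖c‖, fun a x _ l _ => ?_⟩
  rcases eq_or_ne l 0 with rfl | h
  · rw [norm_iteratedFDeriv_zero]
  · rw [iteratedFDeriv_const_of_ne h]; simp

theorem sum (hΩ : ∀ a, IsOpen (Ω a)) {κ : Type*} (s : Finset κ) {f : κ → ι → E → F}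
    (h : ∀ i ∈ s, UnifBdd Ω j (f i)) : UnifBdd Ω j fun a x => ∑ i ∈ s, f i a x := by
  classical
  induction s using Finset.induction_on with
  | empty => simpa using const 0
  | insert i s hi ih =>
    simp only [Finset.sum_insert hi]
    exact (h i (Finset.mem_insert_self i s)).add hΩ
      (ih fun i' hi' => h i' (Finset.mem_insert_of_mem hi'))

theorem bilin (hΩ : ∀ a, IsOpen (Ω a)) {f : ι → E → F} {g : ι → E → G} (B : F →L[ℝ] G →L[ℝ] H)
    (hf : UnifBdd Ω j f) (hg : UnifBdd Ω j g) : UnifBdd Ω j fun a x => B (f a x) (g a x) := by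
  obtain ⟨C, hC⟩ := hf.bound
  obtain ⟨C', hC'⟩ := hg.bound
  refine ⟨fun a => (B.contDiff.comp_contDiffOn (hf.contDiffOn a)).clm_apply (hg.contDiffOn a),
    ‖B‖ * (2 ^ j * |C| * |C'|), fun a x hx l hl => ?_⟩
  have h := B.norm_iteratedFDerivWithin_le_of_bilinear (hf.contDiffOn a) (hg.contDiffOn a)
    (hΩ a).uniqueDiffOn hx (n := l) (by exact_mod_cast hl)
  simp only [iteratedFDerivWithin_of_isOpen _ (hΩ a) hx] at h
  refine h.trans ?_
  gcongr
  calc ∑ i ∈ Finset.range (l + 1), (l.choose i : ℝ) * ‖iteratedFDeriv ℝ i (f a) x‖ *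
        ‖iteratedFDeriv ℝ (l - i) (g a) x‖
      ≤ ∑ i ∈ Finset.range (l + 1), (l.choose i : ℝ) * |C| * |C'| := by
        refine Finset.sum_le_sum fun i hi => ?_
        have hi := Finset.mem_range_succ_iff.1 hi
        gcongr
        · exact (hC a x hx i (hi.trans hl)).trans (le_abs_self C)
        · exact (hC' a x hx _ ((Nat.sub_le l i).trans hl)).trans (le_abs_self C')
    _ = 2 ^ l * |C| * |C'| := by
        rw [← Finset.sum_mul, ← Finset.sum_mul, ← Nat.cast_sum, Nat.sum_range_choose]; simp
    _ ≤ 2 ^ j * |C| * |C'| := by gcongr; norm_num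

theorem succ (hΩ : ∀ a, IsOpen (Ω a)) {f : ι → E → F} (h0 : UnifBdd Ω 0 f)
    (hd : ∀ a, ∀ x ∈ Ω a, DifferentiableAt ℝ (f a) x)
    (hf' : UnifBdd Ω j fun a => fderiv ℝ (f a)) : UnifBdd Ω (j + 1) f := by
  obtain ⟨C, hC⟩ := h0.bound
  obtain ⟨C', hC'⟩ := hf'.bound
  refine ⟨fun a => ?_, max C C', fun a x hx l hl => ?_⟩
  · have := (contDiffOn_succ_iff_fderiv_of_isOpen (n := (j : WithTop ℕ∞)) (hΩ a)).2
      ⟨fun x hx => (hd a x hx).differentiableWithinAt, by simp, hf'.contDiffOn a⟩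
    exact_mod_cast this
  · cases l with
    | zero => exact (hC a x hx 0 le_rfl).trans (le_max_left _ _)
    | succ l =>
      rw [← norm_iteratedFDeriv_fderiv]
      exact (hC' a x hx l (by omega)).trans (le_max_right _ _)

theorem fderiv (hΩ : ∀ a, IsOpen (Ω a)) {f : ι → E → F} (h : UnifBdd Ω (j + 1) f) :
    UnifBdd Ω j fun a => fderiv ℝ (f a) := by
  obtain ⟨C, hC⟩ := h.bound
  refine ⟨fun a => ?_, C, fun a x hx l hl => ?_⟩
  · have := h.contDiffOn a
    push_cast at this
    exact ((contDiffOn_succ_iff_fderiv_of_isOpen (hΩ a)).1 this).2.2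
  · rw [norm_iteratedFDeriv_fderiv]
    exact hC a x hx (l + 1) (by omega)

/-- Since `g' = -g f' g`, each order of boundedness of `g` yields the next, so a bound on the
inverse itself suffices to start. -/
theorem ring_inverse {R : Type*} [NormedRing R] [NormedAlgebra ℝ R] [CompleteSpace R]
    (hΩ : ∀ a, IsOpen (Ω a)) {f g : ι → E → R} (hf : UnifBdd Ω j f) (hg : UnifBdd Ω 0 g)
    (h₁ : ∀ a, ∀ x ∈ Ω a, f a x * g a x = 1) (h₂ : ∀ a, ∀ x ∈ Ω a, g a x * f a x = 1) :
    UnifBdd Ω j g := by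
  induction j with
  | zero => exact hg
  | succ j ih =>
    have hgj := ih (hf.mono (Nat.le_succ j))
    have hd : ∀ a, ∀ x ∈ Ω a, HasFDerivAt (g a)
        (-(ContinuousLinearMap.compL ℝ E R R
          (ContinuousLinearMap.mulLeftRight ℝ R (g a x) (g a x)) (_root_.fderiv ℝ (f a) x))) x := by
      intro a x hx
      have hfd := ((hf.contDiffAt hΩ hx (Nat.le_add_left 1 j)).differentiableAt
        (by simp)).hasFDerivAt
      let u : Rˣ := ⟨f a x, g a x, h₁ a x hx, h₂ a x hx⟩
      have h := (hasFDerivAt_ringInverse (𝕜 := ℝ) u).comp x (f := f a) hfd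
      refine (h.congr_of_eventuallyEq ?_).congr_fderiv (by ext; simp [u])
      filter_upwards [(hΩ a).mem_nhds hx] with y hy
      exact (Ring.inverse_unit ⟨f a y, g a y, h₁ a y hy, h₂ a y hy⟩).symm
    refine succ hΩ hg (fun a x hx => (hd a x hx).differentiableAt) ?_
    refine congr hΩ (neg hΩ (bilin hΩ (ContinuousLinearMap.compL ℝ E R R)
      (bilin hΩ (ContinuousLinearMap.mulLeftRight ℝ R) hgj hgj) (hf.fderiv hΩ)))
      fun a x hx => (hd a x hx).fderiv

end UnifBdd

end UniformBounds

/-! ### Induction on the order of the bounded derivatives. -/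

section Bootstrap

variable {ι : Type*} {d N J : ℕ}

/-- The operator `x ↦ 1 + ∑ l, ⟪v l, w⟫ P ∘ T l`, where `P = 1 - ∑ l, v l ⊗ v l`. -/
noncomputable def shapeOp (v : Fin N → EucSp d) (w : EucSp d) (T : Fin N → EucSp d →L[ℝ] EucSp d) :
    EucSp d →L[ℝ] EucSp d :=
  1 + ∑ l, inner ℝ (v l) w • ((1 - frameProj v) ∘L T l)

theorem UnifBdd.frameProj {Ω : ι → Set (EucSp d)} {j : ℕ} (hΩ : ∀ a, IsOpen (Ω a))
    {v : Fin N → ι → EucSp d → EucSp d} (hv : ∀ l, UnifBdd Ω j (v l)) :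
    UnifBdd Ω j fun a x => frameProj fun l => v l a x :=
  sum hΩ _ fun l _ => bilin hΩ (ContinuousLinearMap.smulRightL ℝ (EucSp d) (EucSp d))
    ((hv l).clm_comp hΩ (innerSL ℝ)) (hv l)

theorem UnifBdd.shapeOp {Ω : ι → Set (EucSp d)} {j : ℕ} (hΩ : ∀ a, IsOpen (Ω a))
    {v : Fin N → ι → EucSp d → EucSp d} {w : ι → EucSp d → EucSp d}
    {T : Fin N → ι → EucSp d → EucSp d →L[ℝ] EucSp d} (hv : ∀ l, UnifBdd Ω j (v l))
    (hw : UnifBdd Ω j w) (hT : ∀ l, UnifBdd Ω j (T l)) :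
    UnifBdd Ω j fun a x => shapeOp (fun l => v l a x) (w a x) fun l => T l a x := by
  refine (const 1).add hΩ (sum hΩ _ fun l _ => ?_)
  exact bilin hΩ (ContinuousLinearMap.lsmul ℝ ℝ) (bilin hΩ (innerSL ℝ) (hv l) hw)
    (bilin hΩ (ContinuousLinearMap.compL ℝ _ _ _) ((const 1).sub hΩ (UnifBdd.frameProj hΩ hv))
      (hT l))

/-- If the tangential derivatives of the frames, transported by `p`, are bounded, then so are the
derivatives of `p`. -/
theorem unifBdd_fderiv_of_tower {Ω : ι → Set (EucSp d)} (hΩ : ∀ a, IsOpen (Ω a))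
    {p : EucSp d → EucSp d} (hp : ∀ a, ContDiffOn ℝ J p (Ω a)) {L ε C : ℝ}
    (hA : ∀ a, ∀ x ∈ Ω a, ‖fderiv ℝ p x‖ ≤ L) (hw : ∀ a, ∀ x ∈ Ω a, ‖x - p x‖ ≤ ε)
    {n : Fin N → (i : ℕ) → ι → EucSp d →
      ContinuousMultilinearMap ℝ (fun _ : Fin i => EucSp d) (EucSp d)}
    (hn : ∀ l i, i ≤ J → ∀ a, ContDiffOn ℝ (J - i : ℕ) (n l i a) (Ω a))
    (hnC : ∀ l i, i ≤ J → ∀ a, ∀ x ∈ Ω a, ‖n l i a x‖ ≤ C)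
    (hn' : ∀ l i, i < J → ∀ a, ∀ x ∈ Ω a, fderiv ℝ (n l i a) x =
      (n l (i + 1) a x).curryLeft ∘L fderiv ℝ p x)
    (hB : ∀ a, ∀ x ∈ Ω a, shapeOp (fun l => continuousMultilinearCurryFin0 ℝ (EucSp d) (EucSp d) (n l 0 a x))
        (x - p x) (fun l => continuousMultilinearCurryFin1 ℝ (EucSp d) (EucSp d) (n l 1 a x)) *
      (fderiv ℝ p x +
        frameProj fun l => continuousMultilinearCurryFin0 ℝ (EucSp d) (EucSp d) (n l 0 a x)) = 1)
    {j : ℕ} (hj : j + 1 ≤ J) : UnifBdd Ω j fun _ : ι => fderiv ℝ p := by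
  have hpd : ∀ a, ∀ x ∈ Ω a, DifferentiableAt ℝ p x := fun a x hx =>
    ((hp a).contDiffAt ((hΩ a).mem_nhds hx)).differentiableAt (by
      have : J ≠ 0 := by omega
      exact_mod_cast this)
  have hA0 : UnifBdd Ω 0 fun _ : ι => fderiv ℝ p := by
    refine UnifBdd.zero (fun a => ?_) hA
    exact (hp a).continuousOn_fderiv_of_isOpen (hΩ a) (by exact_mod_cast (by omega : 1 ≤ J))
  have hn0 : ∀ l i, i ≤ J → UnifBdd Ω 0 (n l i) := fun l i hi =>
    UnifBdd.zero (fun a => (hn l i hi a).continuousOn) (hnC l i hi)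
  have hw0 : UnifBdd Ω 0 fun (_ : ι) x => x - p x :=
    UnifBdd.zero (fun a => continuousOn_id.sub (hp a).continuousOn) hw
  -- The gain of one order: the derivative of level `i` of the tower is level `i + 1` times `Dp`.
  -- Hence `s` derivatives of level `i` use the tower up to level `i + s`.
  have hnstep : ∀ j, (UnifBdd Ω j fun _ : ι => fderiv ℝ p) → ∀ s, s ≤ j + 1 → ∀ l i, i + s ≤ J →
      UnifBdd Ω s (n l i) := by
    intro j hAj s
    induction s with
    | zero => exact fun _ l i hi => hn0 l i hi
    | succ s ih =>
      intro hs l i hi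
      refine UnifBdd.succ hΩ (hn0 l i (by omega)) (fun a x hx => ?_) ?_
      · refine ((hn l i (by omega) a).contDiffAt ((hΩ a).mem_nhds hx)).differentiableAt ?_
        have : J - i ≠ 0 := by omega
        exact_mod_cast this
      · refine UnifBdd.congr hΩ (UnifBdd.bilin hΩ (ContinuousLinearMap.compL ℝ _ _ _)
          ((ih (by omega) l (i + 1) (by omega)).isometryEquiv_comp hΩ
            (continuousMultilinearCurryLeftEquiv ℝ (fun _ : Fin (i + 1) => EucSp d) (EucSp d)))
          (hAj.mono (by omega))) ?_
        intro a x hx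
        exact hn' l i (by omega) a x hx
  induction j with
  | zero => exact hA0
  | succ j ih =>
    have hAj := ih (by omega)
    have hG : ∀ l, UnifBdd Ω (j + 1)
        fun a x => continuousMultilinearCurryFin0 ℝ (EucSp d) (EucSp d) (n l 0 a x) := fun l =>
      (hnstep j hAj (j + 1) le_rfl l 0 (by omega)).isometryEquiv_comp hΩ
        (continuousMultilinearCurryFin0 ℝ (EucSp d) (EucSp d))
    have hT : ∀ l, UnifBdd Ω (j + 1)
        fun a x => continuousMultilinearCurryFin1 ℝ (EucSp d) (EucSp d) (n l 1 a x) := fun l =>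
      (hnstep j hAj (j + 1) le_rfl l 1 (by omega)).isometryEquiv_comp hΩ
        (continuousMultilinearCurryFin1 ℝ (EucSp d) (EucSp d))
    have hwj : UnifBdd Ω (j + 1) fun (_ : ι) x => x - p x := by
      refine UnifBdd.succ hΩ hw0 (fun a x hx => differentiableAt_id.sub (hpd a x hx)) ?_
      refine UnifBdd.congr hΩ
        ((UnifBdd.const (ContinuousLinearMap.id ℝ (EucSp d))).sub hΩ hAj) fun a x hx => ?_
      exact ((hasFDerivAt_id x).sub (hpd a x hx).hasFDerivAt).fderiv
    have hR := UnifBdd.frameProj hΩ hG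
    -- The inverse of the shape operator is `Dp` plus the normal projection, which is already
    -- bounded at order zero. In finite dimension the one-sided identity `hB` gives the other side.
    have hE := UnifBdd.ring_inverse hΩ (UnifBdd.shapeOp hΩ hG hwj hT)
      (hA0.add hΩ (hR.mono (Nat.zero_le _))) hB
      fun a x hx => by
        have h := congrArg (fun f : EucSp d →L[ℝ] EucSp d => (f : EucSp d →ₗ[ℝ] EucSp d))
          (hB a x hx)
        ext1 y
        exact LinearMap.congr_fun (mul_eq_one_comm.1
          (show (_ : EucSp d →ₗ[ℝ] EucSp d) * (_ : EucSp d →ₗ[ℝ] EucSp d) = 1 from h)) y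
    simpa using hE.sub hΩ hR

end Bootstrap

/-! ### Composition with linear isometries, used for currying. -/

section IsometryEquiv

variable {E F G : Type*} [NormedAddCommGroup E] [NormedSpace ℝ E] [NormedAddCommGroup F]
  [NormedSpace ℝ F] [NormedAddCommGroup G] [NormedSpace ℝ G]

theorem LinearIsometryEquiv.contDiffOn_comp (e : F ≃ₗᵢ[ℝ] G) {f : E → F} {s : Set E}
    {n : WithTop ℕ∞} (h : ContDiffOn ℝ n f s) : ContDiffOn ℝ n (fun x => e (f x)) s :=
  e.contDiff.comp_contDiffOn h

theorem LinearIsometryEquiv.hasFDerivAt_comp (e : F ≃ₗᵢ[ℝ] G) {f : E → F} {f' : E →L[ℝ] F} {x : E}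
    (h : HasFDerivAt f f' x) :
    HasFDerivAt (fun x => e (f x)) ((e.toContinuousLinearEquiv : F →L[ℝ] G) ∘L f') x :=
  (e.toContinuousLinearEquiv : F →L[ℝ] G).hasFDerivAt.comp x h

end IsometryEquiv

/-! ### Tangential derivatives pulled back by the nearest point map. -/

section Tangential

variable {d : ℕ} {M V : Set (EucSp d)} {r ε : ℝ}

/-- The points of the `ε`-neighbourhood of `M` whose nearest point lies in `V`. -/
def tubeOver (M V : Set (EucSp d)) (ε : ℝ) : Set (EucSp d) :=
  thickening ε M ∩ nearestPt M ⁻¹' V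

theorem isOpen_tubeOver (hM : thickening r M ⊆ unpp M) (hεr : ε < r) (hV : IsOpenSubset M V) :
    IsOpen (tubeOver M V ε) := by
  obtain ⟨O, hO, rfl⟩ := hV
  have h : tubeOver M (M ∩ O) ε = thickening ε M ∩ nearestPt M ⁻¹' O := by
    ext x
    simp only [tubeOver, mem_inter_iff, mem_preimage]
    exact ⟨fun h => ⟨h.1, h.2.2⟩,
      fun h => ⟨h.1, nearestPt_mem (hM (thickening_mono hεr.le M h.1)), h.2⟩⟩
  rw [h]
  exact ContinuousOn.isOpen_inter_preimage (fun x hx => (continuousAt_nearestPt hM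
    (thickening_mono hεr.le M hx)).continuousWithinAt) isOpen_thickening hO

theorem IsOpenSubset.subset (hV : IsOpenSubset M V) : V ⊆ M := by
  obtain ⟨O, -, rfl⟩ := hV
  exact inter_subset_left

theorem nearestPt_of_mem_subset (hM : thickening r M ⊆ unpp M) (hε : 0 < ε) (hεr : ε < r)
    (hV : IsOpenSubset M V) {η : EucSp d} (hη : η ∈ V) : nearestPt M η = η :=
  nearestPt_of_mem (hε.trans hεr) hM (hV.subset hη)

theorem subset_tubeOver (hM : thickening r M ⊆ unpp M) (hε : 0 < ε) (hεr : ε < r)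
    (hV : IsOpenSubset M V) : V ⊆ tubeOver M V ε := fun η hη =>
  ⟨self_subset_thickening hε M (hV.subset hη), by
    rw [mem_preimage, nearestPt_of_mem_subset hM hε hεr hV hη]; exact hη⟩

theorem mapsTo_nearestPt_tubeOver : MapsTo (nearestPt M) (tubeOver M V ε) V := fun _ hx => hx.2

variable {F : Type*} [NormedAddCommGroup F] [NormedSpace ℝ F] {f : EucSp d → F}

/-- Composition with the nearest point map extends `f` from `V` to an open set, so tangential
derivatives become ordinary Fréchet derivatives restricted to the tangent space. -/
theorem tangentialFDeriv_eq (hM : thickening r M ⊆ unpp M) (hε : 0 < ε) (hεr : ε < r)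
    (hV : IsOpenSubset M V) {η : EucSp d} (hη : η ∈ V)
    (hf : DifferentiableAt ℝ (fun y => f (nearestPt M y)) η) :
    tangentialFDeriv M V f η =
      fderiv ℝ (fun y => f (nearestPt M y)) η ∘L (tangentSp M η).starProjection := by
  have h1 : HasFDerivWithinAt f (fderiv ℝ (fun y => f (nearestPt M y)) η) V η :=
    hf.hasFDerivAt.hasFDerivWithinAt.congr
      (fun y hy => by simp only [nearestPt_of_mem_subset hM hε hεr hV hy])
      (by simp only [nearestPt_of_mem_subset hM hε hεr hV hη])
  ext h
  exact HasFDerivWithinAt.eq_on_tangentSp hV hη h1.differentiableWithinAt.hasFDerivWithinAt h1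
    (Submodule.starProjection_apply_mem _ _)

theorem fderiv_nearestPt_mem (hM : thickening r M ⊆ unpp M) (hεr : ε < r) {x : EucSp d}
    (hx : x ∈ thickening ε M) (hp : ContDiffAt ℝ 1 (nearestPt M) x) (h : EucSp d) :
    fderiv ℝ (nearestPt M) x h ∈ tangentSp M (nearestPt M x) :=
  fderiv_apply_mem_tangentSp hp (eventually_of_mem (isOpen_thickening.mem_nhds hx)
    fun _ hy => nearestPt_mem (hM (thickening_mono hεr.le M hy))) h

/-- Idempotence of the nearest point map allows the chain rule at `nearestPt M x`. The tangential
projection is harmless because the derivative of the nearest point map takes tangent values. -/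
theorem fderiv_comp_nearestPt (hM : thickening r M ⊆ unpp M) (hε : 0 < ε) (hεr : ε < r)
    (hV : IsOpenSubset M V) {x : EucSp d} (hx : x ∈ tubeOver M V ε)
    (hp : ContDiffAt ℝ 1 (nearestPt M) x)
    (hf : DifferentiableAt ℝ (fun y => f (nearestPt M y)) (nearestPt M x)) :
    fderiv ℝ (fun y => f (nearestPt M y)) x =
      tangentialFDeriv M V f (nearestPt M x) ∘L fderiv ℝ (nearestPt M) x := by
  have h1 : (fun y => f (nearestPt M y)) =ᶠ[𝓝 x]
      (fun y => f (nearestPt M y)) ∘ nearestPt M := by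
    filter_upwards [(isOpen_tubeOver hM hεr hV).mem_nhds hx] with y hy
    simp only [Function.comp_apply]
    rw [nearestPt_of_mem_subset hM hε hεr hV hy.2]
  rw [h1.fderiv_eq, fderiv_comp x hf (hp.differentiableAt (by simp)),
    tangentialFDeriv_eq hM hε hεr hV hx.2 hf]
  ext h
  simp [Submodule.starProjection_eq_self_iff.2 (fderiv_nearestPt_mem hM hεr hx.1 hp h)]

theorem contDiffOn_iteratedTangentialFDeriv (hM : thickening r M ⊆ unpp M) (hε : 0 < ε)
    (hεr : ε < r) (hV : IsOpenSubset M V) {J : ℕ}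
    (hp : ContDiffOn ℝ J (nearestPt M) (thickening ε M)) (hf : ContDiffOn ℝ J f V)
    (hT : ContDiffOn ℝ J (fun x => (tangentSp M (nearestPt M x)).starProjection)
      (tubeOver M V ε)) {j : ℕ} (hj : j ≤ J) :
    ContDiffOn ℝ (J - j : ℕ) (fun x => iteratedTangentialFDeriv M V f j (nearestPt M x))
      (tubeOver M V ε) := by
  have hpΩ : ContDiffOn ℝ J (nearestPt M) (tubeOver M V ε) := hp.mono inter_subset_left
  have hΩ := isOpen_tubeOver hM hεr hV
  have hVΩ := subset_tubeOver hM hε hεr hV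
  induction j with
  | zero =>
    have h0 : ContDiffOn ℝ J (fun x => f (nearestPt M x)) (tubeOver M V ε) :=
      hf.comp hpΩ mapsTo_nearestPt_tubeOver
    rw [Nat.sub_zero]
    exact (continuousMultilinearCurryFin0 ℝ (EucSp d) F).symm.contDiffOn_comp h0
  | succ j ih =>
    have h0 := ih (by omega)
    set g := fun x => iteratedTangentialFDeriv M V f j (nearestPt M x) with hg
    have h1 : ContDiffOn ℝ (J - (j + 1) : ℕ) (fderiv ℝ g) (tubeOver M V ε) := by
      refine h0.fderiv_of_isOpen hΩ ?_
      exact_mod_cast (by omega : J - (j + 1) + 1 ≤ J - j)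
    have hle : ((J - (j + 1) : ℕ) : WithTop ℕ∞) ≤ J := by exact_mod_cast Nat.sub_le _ _
    have h2 : ContDiffOn ℝ (J - (j + 1) : ℕ) (fun x => fderiv ℝ g (nearestPt M x) ∘L
        (tangentSp M (nearestPt M x)).starProjection) (tubeOver M V ε) :=
      (h1.comp (hpΩ.of_le hle) fun x hx => hVΩ hx.2).clm_comp (hT.of_le hle)
    have h4 := (continuousMultilinearCurryLeftEquiv ℝ (fun _ : Fin (j + 1) => EucSp d)
      F).symm.contDiffOn_comp h2
    refine h4.congr fun x hx => ?_
    have hgd : DifferentiableAt ℝ g (nearestPt M x) :=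
      (h0.contDiffAt (hΩ.mem_nhds (hVΩ hx.2))).differentiableAt (by
        have : J - j ≠ 0 := by omega
        exact_mod_cast this)
    have h3 := tangentialFDeriv_eq hM hε hεr hV hx.2 hgd
    simp only [iteratedTangentialFDeriv]
    rw [h3]
    rfl

theorem fderiv_iteratedTangentialFDeriv (hM : thickening r M ⊆ unpp M) (hε : 0 < ε)
    (hεr : ε < r) (hV : IsOpenSubset M V) {J : ℕ}
    (hp : ContDiffOn ℝ J (nearestPt M) (thickening ε M)) (hf : ContDiffOn ℝ J f V)
    (hT : ContDiffOn ℝ J (fun x => (tangentSp M (nearestPt M x)).starProjection)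
      (tubeOver M V ε)) {j : ℕ} (hj : j < J) {x : EucSp d} (hx : x ∈ tubeOver M V ε) :
    fderiv ℝ (fun y => iteratedTangentialFDeriv M V f j (nearestPt M y)) x =
      (iteratedTangentialFDeriv M V f (j + 1) (nearestPt M x)).curryLeft ∘L
        fderiv ℝ (nearestPt M) x := by
  have h0 := contDiffOn_iteratedTangentialFDeriv hM hε hεr hV hp hf hT hj.le
  have h1 := (h0.contDiffAt ((isOpen_tubeOver hM hεr hV).mem_nhds
    (subset_tubeOver hM hε hεr hV hx.2))).differentiableAt (by
      have : J - j ≠ 0 := by omega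
      exact_mod_cast this)
  have hp1 : ContDiffAt ℝ 1 (nearestPt M) x :=
    (hp.contDiffAt (isOpen_thickening.mem_nhds hx.1)).of_le (by
      exact_mod_cast (by omega : 1 ≤ J))
  rw [fderiv_comp_nearestPt hM hε hεr hV hx hp1 h1]
  simp only [iteratedTangentialFDeriv, ContinuousLinearMap.curry_uncurryLeft]

theorem iteratedTangentialFDeriv_one_starProjection {η : EucSp d} (h : EucSp d) :
    continuousMultilinearCurryFin1 ℝ (EucSp d) F (iteratedTangentialFDeriv M V f 1 η)
      ((tangentSp M η).starProjection h) =
    continuousMultilinearCurryFin1 ℝ (EucSp d) F (iteratedTangentialFDeriv M V f 1 η) h := by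
  have h1 : ∀ g, continuousMultilinearCurryFin1 ℝ (EucSp d) F (iteratedTangentialFDeriv M V f 1 η) g
      = tangentialFDeriv M V (iteratedTangentialFDeriv M V f 0) η g 0 := fun g => by
    simp only [continuousMultilinearCurryFin1_apply, iteratedTangentialFDeriv,
      ContinuousLinearMap.uncurryLeft_apply]
    congr 1
    exact Subsingleton.elim _ _
  rw [h1, h1]
  simp only [tangentialFDeriv, ContinuousLinearMap.comp_apply]
  rw [Submodule.starProjection_eq_self_iff.2 (Submodule.starProjection_apply_mem _ h)]

theorem hasFDerivAt_comp_nearestPt (hM : thickening r M ⊆ unpp M) (hε : 0 < ε)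
    (hεr : ε < r) (hV : IsOpenSubset M V) {J : ℕ}
    (hp : ContDiffOn ℝ J (nearestPt M) (thickening ε M)) (hf : ContDiffOn ℝ J f V)
    (hT : ContDiffOn ℝ J (fun x => (tangentSp M (nearestPt M x)).starProjection)
      (tubeOver M V ε)) (hJ : 1 ≤ J) {x : EucSp d} (hx : x ∈ tubeOver M V ε) :
    HasFDerivAt (fun y => f (nearestPt M y))
      (continuousMultilinearCurryFin1 ℝ (EucSp d) F
        (iteratedTangentialFDeriv M V f 1 (nearestPt M x)) ∘L fderiv ℝ (nearestPt M) x) x := by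
  have h0 := contDiffOn_iteratedTangentialFDeriv hM hε hεr hV hp hf hT (Nat.zero_le J)
  have h1 := ((h0.contDiffAt ((isOpen_tubeOver hM hεr hV).mem_nhds hx)).differentiableAt (by
      have : J - 0 ≠ 0 := by omega
      exact_mod_cast this)).hasFDerivAt
  rw [fderiv_iteratedTangentialFDeriv hM hε hεr hV hp hf hT hJ hx] at h1
  have h2 := (continuousMultilinearCurryFin0 ℝ (EucSp d) F).hasFDerivAt_comp h1
  refine (h2.congr_of_eventuallyEq ?_).congr_fderiv ?_
  · exact Eventually.of_forall fun y => rfl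
  · ext h
    simp only [ContinuousLinearMap.comp_apply, continuousMultilinearCurryFin1_apply,
      ContinuousLinearEquiv.coe_coe, LinearIsometryEquiv.coe_toContinuousLinearEquiv,
      continuousMultilinearCurryFin0_apply, ContinuousMultilinearMap.curryLeft_apply]
    congr 1
    ext i
    fin_cases i
    simp [Fin.snoc]

/-- For a unit field, the first derivative is controlled by the second one. -/
theorem norm_iteratedTangentialFDeriv_one_le {n : EucSp d → EucSp d}
    (hM : thickening r M ⊆ unpp M) (hε : 0 < ε) (hεr : ε < r) (hV : IsOpenSubset M V) {J : ℕ}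
    (hJ : 2 ≤ J) (hp : ContDiffOn ℝ J (nearestPt M) (thickening ε M)) (hn : ContDiffOn ℝ J n V)
    (hT : ContDiffOn ℝ J (fun x => (tangentSp M (nearestPt M x)).starProjection)
      (tubeOver M V ε)) (h1 : ∀ η ∈ V, ‖n η‖ = 1) {K : ℝ} {η : EucSp d} (hη : η ∈ V)
    (hK : ‖iteratedTangentialFDeriv M V n 2 η‖ ≤ K) :
    ‖iteratedTangentialFDeriv M V n 1 η‖ ≤ √K := by
  have hΩ := isOpen_tubeOver hM hεr hV
  have hVΩ := subset_tubeOver hM hε hεr hV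
  have hpη : ∀ y ∈ V, nearestPt M y = y := fun y hy => nearestPt_of_mem_subset hM hε hεr hV hy
  have hpT : ∀ y ∈ V, ∀ t ∈ tangentSp M y, fderiv ℝ (nearestPt M) y t = t := by
    intro y hy t ht
    have hyM := hV.subset hy
    refine fderiv_retraction_apply isOpen_thickening (fun z hz => nearestPt_of_mem
      (hε.trans hεr) hM hz.2) ⟨(hVΩ hy).1, hyM⟩ ?_ ht
    exact (hp.contDiffAt (isOpen_thickening.mem_nhds (hVΩ hy).1)).differentiableAt (by
      have : J ≠ 0 := by omega
      exact_mod_cast this)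
  set a : EucSp d → EucSp d →L[ℝ] EucSp d := fun x =>
    continuousMultilinearCurryFin1 ℝ (EucSp d) (EucSp d)
      (iteratedTangentialFDeriv M V n 1 (nearestPt M x)) with ha
  have hG : ∀ x ∈ tubeOver M V ε, HasFDerivAt (fun y => n (nearestPt M y))
      (a x ∘L fderiv ℝ (nearestPt M) x) x := fun x hx =>
    hasFDerivAt_comp_nearestPt hM hε hεr hV hp hn hT (by omega) hx
  have haP : ∀ x u, a x ((tangentSp M (nearestPt M x)).starProjection u) = a x u := fun x u =>
    iteratedTangentialFDeriv_one_starProjection u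
  -- Differentiate `‖n‖ ^ 2 = 1`.
  have horth : ∀ y ∈ V, ∀ u, inner ℝ (n y) (a y u) = 0 := by
    intro y hy u
    rw [← haP y u, hpη y hy]
    set w := (tangentSp M y).starProjection u
    have hd := (hG y (hVΩ hy)).inner ℝ (hG y (hVΩ hy))
    have hc : (fun z => inner ℝ (n (nearestPt M z)) (n (nearestPt M z))) =ᶠ[𝓝 y]
        fun _ => (1 : ℝ) := by
      filter_upwards [hΩ.mem_nhds (hVΩ hy)] with z hz
      rw [real_inner_self_eq_norm_sq, h1 _ hz.2, one_pow]
    have h2 := DFunLike.congr_fun (hd.unique ((hasFDerivAt_const (1 : ℝ) y).congr_of_eventuallyEq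
      hc)) w
    simp only [ContinuousLinearMap.comp_apply, ContinuousLinearMap.prod_apply, fderivInnerCLM_apply,
      hpη y hy, hpT y hy w (Submodule.starProjection_apply_mem _ _), zero_apply] at h2
    rw [real_inner_comm (n y)] at h2
    linarith
  have had := ((continuousMultilinearCurryFin1 ℝ (EucSp d) (EucSp d)).hasFDerivAt_comp
    (((contDiffOn_iteratedTangentialFDeriv hM hε hεr hV hp hn hT
      (by omega : 1 ≤ J)).contDiffAt (hΩ.mem_nhds (hVΩ hη))).differentiableAt (by
        have : J - 1 ≠ 0 := by omega
        exact_mod_cast this)).hasFDerivAt)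
  rw [fderiv_iteratedTangentialFDeriv hM hε hεr hV hp hn hT (by omega : 1 < J) (hVΩ hη)] at had
  change HasFDerivAt a _ η at had
  -- Differentiating `⟪n, Dn u⟫ = 0` once more in the direction `u` bounds `‖Dn u‖ ^ 2` by `‖D²n‖ *
  -- ‖u‖ ^ 2`; hence the constant `√K`.
  have key : ∀ u ∈ tangentSp M η, ‖a η u‖ ^ 2 =
      -inner ℝ (n η) (iteratedTangentialFDeriv M V n 2 η ![u, u]) := by
    intro u hu
    have hd := (hG η (hVΩ hη)).inner ℝ (had.clm_apply (hasFDerivAt_const u η))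
    have hc : (fun z => inner ℝ (n (nearestPt M z)) (a z u)) =ᶠ[𝓝 η] fun _ => (0 : ℝ) := by
      filter_upwards [hΩ.mem_nhds (hVΩ hη)] with z hz
      have : a z = a (nearestPt M z) := by
        simp only [ha]; rw [hpη _ hz.2]
      rw [this]
      exact horth _ hz.2 u
    have h2 := DFunLike.congr_fun (hd.unique ((hasFDerivAt_const (0 : ℝ) η).congr_of_eventuallyEq
      hc)) u
    simp only [ContinuousLinearMap.comp_apply, ContinuousLinearMap.prod_apply, fderivInnerCLM_apply,
      hpη η hη, hpT η hη u hu, zero_apply, add_apply,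
      ContinuousLinearMap.flip_apply, map_zero, zero_add] at h2
    rw [real_inner_self_eq_norm_sq] at h2
    have h4 : inner ℝ (n η) (iteratedTangentialFDeriv M V n 2 η ![u, u]) + ‖a η u‖ ^ 2 = 0 := by
      simpa using h2
    linarith
  have hbound : ‖a η‖ ≤ √K := by
    refine ContinuousLinearMap.opNorm_le_bound _ (Real.sqrt_nonneg K) fun u => ?_
    rw [← haP, hpη η hη]
    set w := (tangentSp M η).starProjection u with hw
    have hwu : ‖w‖ ≤ ‖u‖ := Submodule.norm_starProjection_apply_le _ u
    refine le_trans ?_ (mul_le_mul_of_nonneg_left hwu (Real.sqrt_nonneg K))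
    have h2 : ‖a η w‖ ^ 2 ≤ K * ‖w‖ ^ 2 := by
      rw [key w (Submodule.starProjection_apply_mem _ _)]
      refine (neg_le_abs _).trans ((abs_real_inner_le_norm _ _).trans ?_)
      rw [h1 η hη, one_mul]
      refine ((iteratedTangentialFDeriv M V n 2 η).le_opNorm _).trans ?_
      rw [Fin.prod_univ_two, Matrix.cons_val_zero, Matrix.cons_val_one, Matrix.cons_val_zero, ← sq]
      gcongr
    have hK0 : 0 ≤ K := (norm_nonneg _).trans hK
    refine le_of_sq_le_sq ?_ (by positivity)
    rwa [mul_pow, Real.sq_sqrt hK0]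
  rwa [ha, LinearIsometryEquiv.norm_map, hpη η hη] at hbound

end Tangential

/-! ### The case of moving frames. -/

section MovingFrames

variable {d N : ℕ}

/-- The derivative of the nearest point map, completed by the normal projection, inverts the shape
operator. -/
theorem shapeOp_mul_eq_one {S : Submodule ℝ (EucSp d)} {p : EucSp d → EucSp d} {x : EucSp d}
    {A : EucSp d →L[ℝ] EucSp d} {G : Fin N → EucSp d → EucSp d}
    {T : Fin N → EucSp d →L[ℝ] EucSp d} (hp : HasFDerivAt p A x)
    (hG : ∀ l, HasFDerivAt (G l) (T l ∘L A) x) (hS : S.starProjection = 1 - frameProj fun l => G l x)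
    (hGS : ∀ l, G l x ∈ Sᗮ) (hA : ∀ h, A h ∈ S) (hT : ∀ l h, T l (S.starProjection h) = T l h)
    (hw : ∀ᶠ y in 𝓝 x, y - p y = frameProj (fun l => G l y) (y - p y)) :
    shapeOp (fun l => G l x) (x - p x) T * (A + frameProj fun l => G l x) = 1 := by
  set P := S.starProjection with hP
  have hR : (frameProj fun l => G l x) = 1 - P := by rw [hS, sub_sub_cancel]
  have hPP : ∀ h, P (P h) = P h := fun h =>
    Submodule.starProjection_eq_self_iff.2 (Submodule.starProjection_apply_mem _ h)
  have hPA : ∀ h, P (A h) = A h := fun h => Submodule.starProjection_eq_self_iff.2 (hA h)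
  have hPG : ∀ l, P (G l x) = 0 := fun l =>
    (Submodule.starProjection_apply_eq_zero_iff _).2 (hGS l)
  have hwd : HasFDerivAt (fun y => y - p y) (ContinuousLinearMap.id ℝ (EucSp d) - A) x :=
    (hasFDerivAt_id x).sub hp
  have hsum : HasFDerivAt (fun y => ∑ l, inner ℝ (G l y) (y - p y) • G l y) _ x :=
    HasFDerivAt.fun_sum fun l _ => ((hG l).inner ℝ hwd).smul (hG l)
  -- Two expressions for the derivative of the normal vector `y - p y`. Applying `P` below kills
  -- every term along a `G l x` and leaves `P h - A h = ∑ l, ⟪G l x, x - p x⟫ P (T l (A h))`.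
  have heq := hwd.unique (hsum.congr_of_eventuallyEq (by
    filter_upwards [hw] with y hy
    rwa [frameProj_apply] at hy))
  ext1 h
  have h1 := congrArg P (DFunLike.congr_fun heq h)
  simp only [sub_apply, ContinuousLinearMap.id_apply, map_sub, hPA, sum_apply, map_sum, add_apply,
    smul_apply, ContinuousLinearMap.smulRight_apply, map_add, map_smul, hPG, smul_zero, add_zero,
    ContinuousLinearMap.comp_apply] at h1
  have hTR : ∀ l, T l (A h + (h - P h)) = T l (A h) := fun l => by
    rw [map_add, ← hT l (h - P h), map_sub, hPP, sub_self, map_zero, add_zero]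
  change shapeOp _ _ _ ((A + frameProj fun l => G l x) h) = h
  simp only [shapeOp, hR, sub_sub_cancel, add_apply, sub_apply, one_apply_eq_self, sum_apply,
    smul_apply, ContinuousLinearMap.comp_apply, hTR]
  rw [← h1]
  abel

variable {k m : ℕ} {M : Set (EucSp d)} {ε : ℝ}

theorem IsSubmanifold.nearestPt_of_movingFrames (hk : 2 ≤ k) (hsub : IsSubmanifold k m M)
    (hε : 0 < ε) (hreach : ENNReal.ofReal ε < reach M) {K : ℝ} {ι : Type*}
    {V : ι → Set (EucSp d)} {n : ι → Fin (d - m) → EucSp d → EucSp d}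
    (hframe : ∀ i, IsMovingFrame m M (V i) (n i))
    (hn : ∀ i l, ContDiffOn ℝ (k - 1 : ℕ) (n i l) (V i)) (hcover : M = ⋃ i, V i)
    (hK : ∀ i l, ∀ j, 2 ≤ j → j ≤ k - 1 → ∀ ξ ∈ V i,
      ‖iteratedTangentialFDeriv M (V i) (n i l) j ξ‖ ≤ K) :
    ContDiffOn ℝ (k - 1 : ℕ) (nearestPt M) (thickening ε M) ∧
      ∀ j, 2 ≤ j → j ≤ k - 1 → ∃ C : ℝ, ∀ x ∈ thickening ε M,
        ‖iteratedFDeriv ℝ j (nearestPt M) x‖ ≤ C := by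
  obtain ⟨r, hεr, hM⟩ := exists_thickening_subset_unpp hreach
  have hPT : ∀ i, ∀ η ∈ V i, (tangentSp M η).starProjection = 1 - frameProj fun l => n i l η :=
    fun i η hη => starProjection_eq_one_sub_frameProj
      (hsub.finrank_tangentSp (by omega) ((hframe i).isOpenSubset.subset hη))
      ((hframe i).orthonormal η hη) fun l => (hframe i).normal l η hη
  have hmem : ∀ x ∈ thickening ε M, ∃ i, nearestPt M x ∈ V i := fun x hx => by
    have := nearestPt_mem (hM (thickening_mono hεr.le M hx))
    rw [hcover] at this
    rw [hcover]
    exact mem_iUnion.1 this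
  have hp : ContDiffOn ℝ (k - 1 : ℕ) (nearestPt M) (thickening ε M) := fun x hx => by
    obtain ⟨i, hi⟩ := hmem x hx
    exact (hsub.contDiffAt_nearestPt hk hM hε hεr hx (hframe i).isOpenSubset hi (hn i)
      (hPT i)).contDiffWithinAt
  refine ⟨hp, fun j hj hjk => ?_⟩
  set J := k - 1 with hJ
  have hJ0 : (J : WithTop ℕ∞) ≠ 0 := by
    have : J ≠ 0 := by omega
    exact_mod_cast this
  have hJ1 : (1 : WithTop ℕ∞) ≤ J := by exact_mod_cast (by omega : 1 ≤ J)
  set Ω : ι → Set (EucSp d) := fun i => tubeOver M (V i) ε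
  have hΩ : ∀ i, IsOpen (Ω i) := fun i => isOpen_tubeOver hM hεr (hframe i).isOpenSubset
  have hT : ∀ i, ContDiffOn ℝ J (fun x => (tangentSp M (nearestPt M x)).starProjection) (Ω i) :=
    fun i => by
      refine ContDiffOn.congr ?_ fun x hx => hPT i _ hx.2
      exact contDiffOn_const.sub (ContDiffOn.frameProj fun l =>
        (hn i l).comp (hp.mono inter_subset_left) mapsTo_nearestPt_tubeOver)
  have hunit : ∀ i l, ∀ η ∈ V i, ‖n i l η‖ = 1 := fun i l η hη =>
    ((hframe i).orthonormal η hη).1 l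
  have hpx : ∀ x ∈ thickening ε M, ContDiffAt ℝ J (nearestPt M) x := fun x hx =>
    hp.contDiffAt (isOpen_thickening.mem_nhds hx)
  -- `L` is the Lipschitz constant of the nearest point map. The entries of `C` bound the frame, its
  -- first derivative and its higher derivatives. The order is `j - 1` because the conclusion
  -- concerns `fderiv`.
  have key := unifBdd_fderiv_of_tower (J := J) (Ω := Ω) hΩ (p := nearestPt M)
    (L := (1 - 2 * ε / (ε + r))⁻¹) (ε := ε) (C := max 1 (max (√K) K))
    (n := fun l i a x => iteratedTangentialFDeriv M (V a) (n a l) i (nearestPt M x))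
    (fun a => hp.mono inter_subset_left) ?_ ?_ ?_ ?_ ?_ ?_ (j := j - 1) (by omega)
  · obtain ⟨C, hC⟩ := key.bound
    refine ⟨C, fun x hx => ?_⟩
    obtain ⟨i, hi⟩ := hmem x hx
    have := hC i x ⟨hx, hi⟩ (j - 1) le_rfl
    rwa [norm_iteratedFDeriv_fderiv, Nat.sub_add_cancel (by omega)] at this
  · intro a x hx
    have hL : 0 ≤ (1 - 2 * ε / (ε + r))⁻¹ := by
      rw [inv_nonneg, sub_nonneg, div_le_one (by linarith)]; linarith
    have := norm_fderiv_le_of_lipschitzOn ℝ (isOpen_thickening.mem_nhds hx.1)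
      (C := ⟨_, hL⟩) (f := nearestPt M) (LipschitzOnWith.of_dist_le_mul fun y hy z hz => by
        rw [dist_eq_norm, dist_eq_norm]
        exact norm_nearestPt_sub_le hM hε hεr hy hz)
    exact this
  · intro a x hx
    have hne : M.Nonempty := ⟨_, (hframe a).isOpenSubset.subset hx.2⟩
    rw [norm_sub_nearestPt (hM (thickening_mono hεr.le M hx.1))]
    exact ((mem_thickening_iff_infDist_lt hne).1 hx.1).le
  · intro l i hi a
    exact contDiffOn_iteratedTangentialFDeriv hM hε hεr (hframe a).isOpenSubset hp (hn a l) (hT a) hi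
  · intro l i hi a x hx
    match i with
    | 0 =>
      refine le_trans (le_of_eq ?_) (le_max_left _ _)
      simp only [iteratedTangentialFDeriv, ContinuousMultilinearMap.uncurry0_norm]
      exact hunit a l _ hx.2
    | 1 =>
      refine le_trans ?_ ((le_max_left _ _).trans (le_max_right _ _))
      exact norm_iteratedTangentialFDeriv_one_le hM hε hεr (hframe a).isOpenSubset (by omega) hp
        (hn a l) (hT a) (hunit a l) hx.2 (hK a l 2 le_rfl (by omega) _ hx.2)
    | i + 2 =>
      refine le_trans ?_ ((le_max_right _ _).trans (le_max_right _ _))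
      exact hK a l (i + 2) (by omega) hi _ hx.2
  · intro l i hi a x hx
    exact fderiv_iteratedTangentialFDeriv hM hε hεr (hframe a).isOpenSubset hp (hn a l) (hT a) hi hx
  · intro a x hx
    have hxu := hM (thickening_mono hεr.le M hx.1)
    refine shapeOp_mul_eq_one (S := tangentSp M (nearestPt M x)) (p := nearestPt M)
      (G := fun l y => n a l (nearestPt M y)) ((hpx x hx.1).differentiableAt hJ0).hasFDerivAt
      (fun l => hasFDerivAt_comp_nearestPt hM hε hεr (hframe a).isOpenSubset hp (hn a l) (hT a)
        (by omega) hx) (hPT a _ hx.2) (fun l => (hframe a).normal l _ hx.2)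
      (fderiv_nearestPt_mem hM hεr hx.1 ((hpx x hx.1).of_le hJ1))
      (fun l h => iteratedTangentialFDeriv_one_starProjection h) ?_
    filter_upwards [(hΩ a).mem_nhds hx] with y hy
    have h1 := (Submodule.starProjection_apply_eq_zero_iff _).2
      (sub_nearestPt_mem_orthogonal (hM (thickening_mono hεr.le M hy.1)))
    rw [hPT a _ hy.2] at h1
    exact sub_eq_zero.1 h1

end MovingFrames

/-! ### Hypersurfaces: existence and uniqueness up to sign of the unit normal. -/

section Hypersurface

variable {d k m : ℕ} {M : Set (EucSp d)}

/-- Tangential derivatives depend only on the germ along `M`, not on the domain. This allows a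
normal field given only at one point and one order to be compared with a fixed smooth one. -/
theorem tangentialFDeriv_congr_smul {F : Type*} [NormedAddCommGroup F] [NormedSpace ℝ F]
    {V W : Set (EucSp d)} (hV : IsOpenSubset M V) (hW : IsOpenSubset M W) {η : EucSp d}
    (hηV : η ∈ V) (hηW : η ∈ W) {f g : EucSp d → F} {c : ℝ} (hc : c ≠ 0)
    (hfg : ∀ᶠ y in 𝓝[M] η, f y = c • g y) :
    tangentialFDeriv M V f η = c • tangentialFDeriv M W g η := by
  have hηM := hV.subset hηV
  have hnhds : ∀ U, IsOpenSubset M U → η ∈ U → 𝓝[U] η = 𝓝[M] η := by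
    rintro _ ⟨O, hO, rfl⟩ hη
    exact nhdsWithin_inter_of_mem' (mem_nhdsWithin_of_mem_nhds (hO.mem_nhds hη.2))
  have hfη := hfg.self_of_nhdsWithin hηM
  have hd : ∀ (f g : EucSp d → F) (V W : Set (EucSp d)) (c : ℝ) (g' : EucSp d →L[ℝ] F),
      IsOpenSubset M V → IsOpenSubset M W → η ∈ V → η ∈ W → (∀ᶠ y in 𝓝[M] η, f y = c • g y) →
      HasFDerivWithinAt g g' W η → HasFDerivWithinAt f (c • g') V η := by
    intro f g V W c g' hV hW hηV hηW h hg
    have h1 : HasFDerivWithinAt (fun y => c • g y) (c • g') V η :=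
      (hg.mono_of_mem_nhdsWithin (by
        rw [hnhds V hV hηV, ← hnhds W hW hηW]; exact self_mem_nhdsWithin)).const_smul c
    exact h1.congr_of_eventuallyEq (by rw [hnhds V hV hηV]; exact h) (h.self_of_nhdsWithin hηM)
  by_cases hg : DifferentiableWithinAt ℝ g W η
  · have h1 := hd f g V W c _ hV hW hηV hηW hfg hg.hasFDerivWithinAt
    ext h
    exact HasFDerivWithinAt.eq_on_tangentSp hV hηV h1.differentiableWithinAt.hasFDerivWithinAt h1
      (Submodule.starProjection_apply_mem _ _)
  -- As `c ≠ 0`, differentiability fails for both maps at once, and both sides take the default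
  -- value zero.
  · have hf : ¬ DifferentiableWithinAt ℝ f V η := fun hf => hg
      (hd g f W V c⁻¹ _ hW hV hηW hηV (hfg.mono fun y hy => by
        rw [hy, smul_smul, inv_mul_cancel₀ hc, one_smul])
        hf.hasFDerivWithinAt).differentiableWithinAt
    simp [tangentialFDeriv, fderivWithin_zero_of_not_differentiableWithinAt hf,
      fderivWithin_zero_of_not_differentiableWithinAt hg]

theorem iteratedTangentialFDeriv_congr_smul {F : Type*} [NormedAddCommGroup F] [NormedSpace ℝ F]
    {V W : Set (EucSp d)} (hV : IsOpenSubset M V) (hW : IsOpenSubset M W)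
    {f g : EucSp d → F} {c : ℝ} (hc : c ≠ 0) (j : ℕ) {η : EucSp d} (hηV : η ∈ V) (hηW : η ∈ W)
    (hfg : ∀ᶠ y in 𝓝[M] η, f y = c • g y) :
    iteratedTangentialFDeriv M V f j η = c • iteratedTangentialFDeriv M W g j η := by
  induction j generalizing η with
  | zero =>
    ext v
    simpa [iteratedTangentialFDeriv] using hfg.self_of_nhdsWithin (hV.subset hηV)
  | succ j ih =>
    have hnhds : ∀ U, IsOpenSubset M U → η ∈ U → ∀ᶠ y in 𝓝[M] η, y ∈ U := by
      rintro _ ⟨O, hO, rfl⟩ hη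
      exact inter_mem self_mem_nhdsWithin (mem_nhdsWithin_of_mem_nhds (hO.mem_nhds hη.2))
    have h1 := tangentialFDeriv_congr_smul hV hW hηV hηW hc
      (f := iteratedTangentialFDeriv M V f j) (g := iteratedTangentialFDeriv M W g j) (by
        filter_upwards [eventually_eventually_nhdsWithin.2 hfg, hnhds V hV hηV, hnhds W hW hηW]
          with y hy hyV hyW using ih hyV hyW hy)
    simp only [iteratedTangentialFDeriv]
    rw [h1]
    ext v
    simp

theorem eq_or_eq_neg_of_finrank_eq_one {S : Submodule ℝ (EucSp d)} (hS : Module.finrank ℝ S = 1)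
    {a b : EucSp d} (ha : a ∈ S) (hb : b ∈ S) (ha1 : ‖a‖ = 1) (hb1 : ‖b‖ = 1) :
    b = a ∨ b = -a := by
  obtain ⟨c, hc⟩ := exists_smul_eq_of_finrank_eq_one hS (x := ⟨a, ha⟩)
    (by intro h; simp [Subtype.ext_iff] at h; simp [h] at ha1) ⟨b, hb⟩
  have hc' : c • a = b := congrArg Subtype.val hc
  have : |c| = 1 := by rw [← hb1, ← hc', norm_smul, ha1, mul_one, Real.norm_eq_abs]
  rcases eq_or_eq_neg_of_abs_eq this with h | h
  · left; rw [← hc', h, one_smul]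
  · right; rw [← hc', h, neg_smul, one_smul]

theorem IsSubmanifold.finrank_orthogonal_tangentSp (hsub : IsSubmanifold k m M) (hk : 1 ≤ k)
    (hm : m + 1 = d) {ξ : EucSp d} (hξ : ξ ∈ M) : Module.finrank ℝ (tangentSp M ξ)ᗮ = 1 := by
  have := (tangentSp M ξ).finrank_add_finrank_orthogonal
  rw [hsub.finrank_tangentSp hk hξ, finrank_euclideanSpace, Fintype.card_fin] at this
  omega

/-- A hypersurface of class `C^k` has local unit normal fields of class `C^(k-1)`. -/
theorem IsSubmanifold.exists_contDiffOn_unitNormal (hsub : IsSubmanifold k m M) (hk : 2 ≤ k)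
    (hm : m + 1 = d) {ξ : EucSp d} (hξ : ξ ∈ M) : ∃ (V : Set (EucSp d)) (ν : EucSp d → EucSp d),
      IsUnitNormalField M V ν ∧ ξ ∈ V ∧ ContDiffOn ℝ (k - 1 : ℕ) ν V := by
  obtain ⟨U, ρ, hU, hξU, hρ, hρU, hρM⟩ := hsub.exists_retraction (by omega) hξ
  obtain ⟨⟨v, hv⟩, hv0⟩ := Module.finrank_pos_iff_exists_ne_zero.1
    (show 0 < Module.finrank ℝ (tangentSp M ξ)ᗮ by
      rw [hsub.finrank_orthogonal_tangentSp (by omega) hm hξ]; exact one_pos)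
  have hv0 : v ≠ 0 := fun h => hv0 (by simp [h])
  have hk1 : (1 : WithTop ℕ∞) ≤ k := by exact_mod_cast (by omega : 1 ≤ k)
  have hk0 : (k : WithTop ℕ∞) ≠ 0 := by
    have : k ≠ 0 := by omega
    exact_mod_cast this
  have hρa : ∀ ζ ∈ U, ContDiffAt ℝ k ρ ζ := fun ζ hζ => hρ.contDiffAt (hU.mem_nhds hζ)
  -- On `M` the derivative of `ρ` fixes tangent vectors, so `f ζ` is normal there. At `ξ` its range
  -- is tangent, so `f ξ = v ≠ 0`, and `f` can be normalised nearby. The derivative of `ρ` costs one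
  -- order of smoothness.
  set f : EucSp d → EucSp d := fun ζ => v - (fderiv ℝ ρ ζ).adjoint v with hf
  have hfξ : f ξ = v := by
    have : (fderiv ℝ ρ ξ).adjoint v = 0 := by
      refine ext_inner_right ℝ fun h => ?_
      rw [ContinuousLinearMap.adjoint_inner_left, inner_zero_left]
      refine Submodule.inner_left_of_mem_orthogonal ?_ hv
      have := fderiv_apply_mem_tangentSp ((hρa ξ hξU).of_le hk1)
        (eventually_of_mem (hU.mem_nhds hξU) hρU) h
      rwa [hρM ξ ⟨hξU, hξ⟩] at this
    simp [hf, this]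
  have hfc : ContDiffOn ℝ (k - 1 : ℕ) f U := by
    have hd : ContDiffOn ℝ (k - 1 : ℕ) (fderiv ℝ ρ) U := hρ.fderiv_of_isOpen hU (by
      exact_mod_cast (by omega : k - 1 + 1 ≤ k))
    refine contDiffOn_const.sub (contDiffOn_euclidean.2 fun i => ?_)
    have h1 : ∀ ζ, ((fderiv ℝ ρ ζ).adjoint v) i =
        inner ℝ v (fderiv ℝ ρ ζ (EuclideanSpace.single i 1)) := fun ζ => by
      rw [← ContinuousLinearMap.adjoint_inner_left, EuclideanSpace.inner_single_right]
      simp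
    simp only [h1]
    exact contDiffOn_const.inner ℝ (hd.clm_apply contDiffOn_const)
  set O := U ∩ f ⁻¹' {0}ᶜ with hO
  have hOo : IsOpen O := hfc.continuousOn.isOpen_inter_preimage hU isOpen_compl_singleton
  have hνc : ContDiffOn ℝ (k - 1 : ℕ) (fun ζ => ‖f ζ‖⁻¹ • f ζ) (M ∩ O) := by
    have h1 : ContDiffOn ℝ (k - 1 : ℕ) f (M ∩ O) := hfc.mono fun ζ hζ => hζ.2.1
    exact ((h1.norm ℝ fun ζ hζ => hζ.2.2).inv fun ζ hζ => norm_ne_zero_iff.2 hζ.2.2).smul h1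
  refine ⟨M ∩ O, fun ζ => ‖f ζ‖⁻¹ • f ζ, ⟨⟨O, hOo, rfl⟩, hνc.continuousOn, fun η hη => ?_,
    fun η hη => ?_⟩, ⟨hξ, hξU, by rw [mem_preimage, hfξ]; exact hv0⟩, hνc⟩
  · have : ‖f η‖ ≠ 0 := norm_ne_zero_iff.2 hη.2.2
    rw [norm_smul, norm_inv, norm_norm, inv_mul_cancel₀ this]
  · refine Submodule.smul_mem _ _ ?_
    rw [Submodule.mem_orthogonal']
    intro t ht
    rw [hf, inner_sub_left, ContinuousLinearMap.adjoint_inner_left,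
      fderiv_retraction_apply hU hρM ⟨hη.2.1, hη.1⟩ ((hρa η hη.2.1).differentiableAt hk0) ht,
      sub_self]

/-- Two unit normal fields of a hypersurface agree up to sign near each common point. -/
theorem IsUnitNormalField.eventually_eq_smul {V W : Set (EucSp d)} {n ν : EucSp d → EucSp d}
    (hdim : ∀ η ∈ M, Module.finrank ℝ (tangentSp M η)ᗮ = 1) (hn : IsUnitNormalField M V n)
    (hν : IsUnitNormalField M W ν) {η : EucSp d} (hηV : η ∈ V) (hηW : η ∈ W) :
    ∃ c : ℝ, |c| = 1 ∧ ∀ᶠ y in 𝓝[M] η, ν y = c • n y := by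
  have hpm : ∀ y ∈ V, y ∈ W → ν y = n y ∨ ν y = -n y := fun y hyV hyW =>
    eq_or_eq_neg_of_finrank_eq_one (hdim y (hn.isOpenSubset.subset hyV)) (hn.normal y hyV)
      (hν.normal y hyW) (hn.norm_eq_one y hyV) (hν.norm_eq_one y hyW)
  have hev : ∀ U, IsOpenSubset M U → η ∈ U → 𝓝[U] η = 𝓝[M] η := by
    rintro _ ⟨O, hO, rfl⟩ hη
    exact nhdsWithin_inter_of_mem' (mem_nhdsWithin_of_mem_nhds (hO.mem_nhds hη.2))
  have hcn : Tendsto n (𝓝[M] η) (𝓝 (n η)) := by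
    rw [← hev V hn.isOpenSubset hηV]; exact hn.continuousOn η hηV
  have hcν : Tendsto ν (𝓝[M] η) (𝓝 (ν η)) := by
    rw [← hev W hν.isOpenSubset hηW]; exact hν.continuousOn η hηW
  have hV : ∀ᶠ y in 𝓝[M] η, y ∈ V := by
    rw [← hev V hn.isOpenSubset hηV]; exact self_mem_nhdsWithin
  have hW : ∀ᶠ y in 𝓝[M] η, y ∈ W := by
    rw [← hev W hν.isOpenSubset hηW]; exact self_mem_nhdsWithin
  have htwo : ∀ y ∈ V, ‖n y + n y‖ = 2 := fun y hy => by
    rw [← two_smul ℝ, norm_smul, hn.norm_eq_one y hy]; norm_num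
  -- The sign cannot switch near `η`: opposite choices would differ by a vector of norm `2`, while
  -- continuity keeps the difference below `1`.
  rcases hpm η hηV hηW with h | h
  · refine ⟨1, abs_one, ?_⟩
    have hlim : Tendsto (fun y => ‖n y - ν y‖) (𝓝[M] η) (𝓝 0) := by
      simpa [h] using (hcn.sub hcν).norm
    filter_upwards [hV, hW, hlim.eventually_lt_const one_pos] with y hyV hyW hy
    rcases hpm y hyV hyW with h' | h'
    · rw [h', one_smul]
    · rw [h', sub_neg_eq_add, htwo y hyV] at hy
      norm_num at hy
  · refine ⟨-1, by simp, ?_⟩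
    have hlim : Tendsto (fun y => ‖n y + ν y‖) (𝓝[M] η) (𝓝 0) := by
      simpa [h] using (hcn.add hcν).norm
    filter_upwards [hV, hW, hlim.eventually_lt_const one_pos] with y hyV hyW hy
    rcases hpm y hyV hyW with h' | h'
    · rw [h', htwo y hyV] at hy
      norm_num at hy
    · rw [h', neg_smul, one_smul]

theorem IsUnitNormalField.isMovingFrame (hm : m + 1 = d) {V : Set (EucSp d)}
    {n : EucSp d → EucSp d} (hn : IsUnitNormalField M V n) :
    IsMovingFrame m M V fun _ => n where
  isOpenSubset := hn.isOpenSubset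
  continuousOn _ := hn.continuousOn
  orthonormal η hη := by
    refine ⟨fun _ => hn.norm_eq_one η hη, fun i j hij => (hij ?_).elim⟩
    ext
    omega
  normal _ := hn.normal

theorem IsSubmanifold.nearestPt_of_unitNormals (hk : 2 ≤ k) (hsub : IsSubmanifold k m M) {ε : ℝ}
    (hε : 0 < ε) (hreach : ENNReal.ofReal ε < reach M) (hm : m + 1 = d) {K : ℝ}
    (hK : ∀ j, 2 ≤ j → j ≤ k - 1 → ∀ ξ ∈ M, ∃ (V : Set (EucSp d)) (n : EucSp d → EucSp d),
      IsUnitNormalField M V n ∧ ξ ∈ V ∧ ‖iteratedTangentialFDeriv M V n j ξ‖ ≤ K) :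
    ContDiffOn ℝ (k - 1 : ℕ) (nearestPt M) (thickening ε M) ∧
      ∀ j, 2 ≤ j → j ≤ k - 1 → ∃ C : ℝ, ∀ x ∈ thickening ε M,
        ‖iteratedFDeriv ℝ j (nearestPt M) x‖ ≤ C := by
  choose V ν hν hmem hνc using fun ξ : M => hsub.exists_contDiffOn_unitNormal hk hm ξ.2
  refine hsub.nearestPt_of_movingFrames hk hε hreach (K := K) (V := V) (n := fun ξ _ => ν ξ)
    (fun ξ => (hν ξ).isMovingFrame hm) (fun ξ _ => hνc ξ) ?_ ?_
  · refine Subset.antisymm (fun ξ hξ => mem_iUnion.2 ⟨⟨ξ, hξ⟩, hmem _⟩)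
      (iUnion_subset fun ξ => (hν ξ).isOpenSubset.subset)
  · intro ξ _ j hj hjk η hη
    -- The field supplied here depends on `j` and `η`; it agrees with `ν ξ` near `η` up to a sign,
    -- which does not affect the norm of the derivative.
    obtain ⟨W, n, hn, hηW, hle⟩ := hK j hj hjk η ((hν ξ).isOpenSubset.subset hη)
    obtain ⟨c, hc, hcn⟩ := IsUnitNormalField.eventually_eq_smul
      (fun y hy => hsub.finrank_orthogonal_tangentSp (by omega) hm hy) hn (hν ξ) hηW hη
    rw [iteratedTangentialFDeriv_congr_smul (hν ξ).isOpenSubset hn.isOpenSubset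
      (by rintro rfl; simp at hc) j hη hηW hcn, norm_smul, Real.norm_eq_abs, hc, one_mul]
    exact hle

end Hypersurface

theorem mainTheorem8 {d m k : ℕ} (hk : 2 ≤ k) (M : Set (EucSp d)) (hM : M.Nonempty)
    (hsub : IsSubmanifold k m M) (ε : ℝ) (hε : 0 < ε) (hreach : ENNReal.ofReal ε < reach M) :
    -- submanifolds of arbitrary codimension, covered by moving frames
    (∀ (K : ℝ) (_ : 0 < K) (ι : Type*) (V : ι → Set (EucSp d))
        (n : ι → Fin (d - m) → EucSp d → EucSp d),
        (∀ i, IsMovingFrame m M (V i) (n i)) →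
        (∀ i l, ContDiffOn ℝ (k - 1 : ℕ) (n i l) (V i)) →
        M = ⋃ i, V i →
        (∀ i l, ∀ j, 2 ≤ j → j ≤ k - 1 → ∀ ξ ∈ V i,
          ‖iteratedTangentialFDeriv M (V i) (n i l) j ξ‖ ≤ K) →
        ContDiffOn ℝ (k - 1 : ℕ) (nearestPt M) (thickening ε M) ∧
        ∀ j, 2 ≤ j → j ≤ k - 1 → ∃ C : ℝ, ∀ x ∈ thickening ε M,
          ‖iteratedFDeriv ℝ j (nearestPt M) x‖ ≤ C) ∧
    -- hypersurfaces, with the (locally defined, up to sign unique) unit normal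
    (m + 1 = d →
      ∀ (K : ℝ) (_ : 0 < K),
        (∀ j, 2 ≤ j → j ≤ k - 1 → ∀ ξ ∈ M, ∃ (V : Set (EucSp d)) (n : EucSp d → EucSp d),
          IsUnitNormalField M V n ∧ ξ ∈ V ∧ ‖iteratedTangentialFDeriv M V n j ξ‖ ≤ K) →
        ContDiffOn ℝ (k - 1 : ℕ) (nearestPt M) (thickening ε M) ∧
        ∀ j, 2 ≤ j → j ≤ k - 1 → ∃ C : ℝ, ∀ x ∈ thickening ε M,
          ‖iteratedFDeriv ℝ j (nearestPt M) x‖ ≤ C) :=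
  ⟨fun _ _ _ _ _ hframe hn hcover hK =>
      hsub.nearestPt_of_movingFrames hk hε hreach hframe hn hcover hK,
    fun hm _ _ hK => hsub.nearestPt_of_unitNormals hk hε hreach hm hK⟩
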